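/- All graphs are finite and simple. For a graph $G$, let $\mathrm{tww}(G)$ be its twin-width, let $\bar\omega(G)$ be the maximum integer $s$ such that $K_{s,s}$ is a (not necessarily induced) subgraph of $G$, and let $\mathrm{scol}_r(G)$ be its strong $r$-colouring number, that is, the minimum over all linear orders $L$ of $V(G)$ of the maximum over $v\in V(G)$ of the number of vertices $u\le_L v$ that are joined to $v$ by a path of length at most $r$ all of whose inner vertices are greater than $v$ in $L$. For every integer $d\ge 14$, every positive integer $s$, and every integer $r$ of the form $2^k$ with $k\ge 0$ an integer, there exists a graph $G$ with $\mathrm{tww}(G)\le d$, $\bar\omega(G)=s$, and $$\mathrm{scol}_r(G)\;\ge\;\frac{ds}{4}\Bigl(\frac{d-4}{8}\Bigr)^{r-1}\;\ge\;2\Bigl(\frac{\mathrm{tww}(G)-4}{8}\Bigr)^{r}\,\bar\omega(G).$$ -/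

import Mathlib

/-- A trigraph on a finite vertex set `V`: its nodes are the parts of a partition of `V`, and it
carries two exclusive (symmetric, loopless) adjacencies between nodes, black and red. -/
structure Trigraph (V : Type*) [Fintype V] [DecidableEq V] where
  /-- the partition of `V` whose parts are the nodes -/
  nodes : Finpartition (Finset.univ : Finset V)
  /-- the black adjacency -/
  black : SimpleGraph (Finset V)
  /-- the red adjacency -/
  red : SimpleGraph (Finset V)
  mem_nodes_of_black : ∀ {X Y : Finset V}, black.Adj X Y → X ∈ nodes.parts
  mem_nodes_of_red : ∀ {X Y : Finset V}, red.Adj X Y → X ∈ nodes.parts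
  exclusive : ∀ {X Y : Finset V}, black.Adj X Y → ¬ red.Adj X Y

namespace Trigraph

variable {V : Type*} [Fintype V] [DecidableEq V]

/-- Adjacency in a trigraph: by a black or by a red edge. -/
def Adj (T : Trigraph V) (X Y : Finset V) : Prop :=
  T.black.Adj X Y ∨ T.red.Adj X Y

/-- `T` is a `d`-trigraph: each node has at most `d` red neighbours. -/
def IsDTrigraph (T : Trigraph V) (d : ℕ) : Prop :=
  ∀ X ∈ T.nodes.parts, (T.red.neighborSet X).ncard ≤ d

/-- `T'` is obtained from `T` by contracting the two distinct nodes `X` and `Y`. -/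
structure IsContraction (T T' : Trigraph V) (X Y : Finset V) : Prop where
  left_mem : X ∈ T.nodes.parts
  right_mem : Y ∈ T.nodes.parts
  ne : X ≠ Y
  nodes_eq : T'.nodes.parts = (T.nodes.parts \ {X, Y}) ∪ {X ∪ Y}
  adj_union : ∀ Z ∈ T.nodes.parts \ {X, Y}, (T'.Adj (X ∪ Y) Z ↔ T.Adj X Z ∨ T.Adj Y Z)
  black_union : ∀ Z ∈ T.nodes.parts \ {X, Y},
    (T'.black.Adj (X ∪ Y) Z ↔ T.black.Adj X Z ∧ T.black.Adj Y Z)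
  black_other : ∀ Z ∈ T.nodes.parts \ {X, Y}, ∀ W ∈ T.nodes.parts \ {X, Y},
    (T'.black.Adj Z W ↔ T.black.Adj Z W)
  red_other : ∀ Z ∈ T.nodes.parts \ {X, Y}, ∀ W ∈ T.nodes.parts \ {X, Y},
    (T'.red.Adj Z W ↔ T.red.Adj Z W)

/-- The trigraph isomorphic to `G`: the nodes are the singletons, the black edges are the edges of
`G`, and there is no red edge. -/
def ofGraph (G : SimpleGraph V) : Trigraph V where
  nodes := ⊥
  black :=
    { Adj := fun X Y => ∃ u v, G.Adj u v ∧ X = {u} ∧ Y = {v}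
      symm := ⟨fun _ _ ⟨u, v, h, hX, hY⟩ => ⟨v, u, h.symm, hY, hX⟩⟩
      loopless := ⟨fun _ ⟨_, _, h, hX, hY⟩ =>
        h.ne (Finset.singleton_injective (hX.symm.trans hY))⟩ }
  red := ⊥
  mem_nodes_of_black := by
    rintro X Y ⟨u, v, -, rfl, -⟩
    simp
  mem_nodes_of_red := fun h => h.elim
  exclusive := fun _ h => h

end Trigraph

namespace SimpleGraph

variable {V : Type*} [Fintype V]

/-- `G` has a `d`-contraction sequence `T n, …, T 1`, where `n` is the number of vertices of `G`:
it starts with the trigraph of `G`, ends with the trigraph with the single node `V`, consists of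
`d`-trigraphs, and each `T i` is obtained from `T (i + 1)` by a single contraction.
(Values of `T` outside `1, …, n` are irrelevant.) -/
def HasContractionSequence [DecidableEq V] (G : SimpleGraph V) (d : ℕ) : Prop :=
  ∃ T : ℕ → Trigraph V,
    T (Fintype.card V) = Trigraph.ofGraph G ∧
    (T 1).nodes.parts = {Finset.univ} ∧
    (∀ i, 1 ≤ i → i ≤ Fintype.card V → (T i).IsDTrigraph d) ∧
    (∀ i, 1 ≤ i → i < Fintype.card V → ∃ X Y, (T (i + 1)).IsContraction (T i) X Y)

/-- The twin-width of a finite (nonempty) graph: the least `d` such that it has a `d`-contraction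
sequence. -/
noncomputable def twinWidth [DecidableEq V] (G : SimpleGraph V) : ℕ :=
  sInf {d | G.HasContractionSequence d}

/-- The largest `s` such that the complete bipartite graph `K_{s,s}` is a (not necessarily induced)
subgraph of `G`. -/
noncomputable def bicliqueNumber (G : SimpleGraph V) : ℕ :=
  sSup {s | (completeBipartiteGraph (Fin s) (Fin s)).IsContained G}

/-- The set of vertices that are strongly `r`-reachable from `v` with respect to the linear
order `L`: those `u ≤ v` joined to `v` by a path of length at most `r` all of whose inner vertices
are greater than `v`. -/
def sreach (G : SimpleGraph V) (L : LinearOrder V) (r : ℕ) (v : V) : Set V :=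
  {u | L.le u v ∧ ∃ p : G.Walk v u, p.IsPath ∧ p.length ≤ r ∧
    ∀ w ∈ p.support, w ≠ v → w ≠ u → L.lt v w}

/-- The strong `r`-colouring number of a finite graph: the minimum over all linear orders of the
vertices of the maximum number of vertices strongly `r`-reachable from a vertex. -/
noncomputable def scol (G : SimpleGraph V) (r : ℕ) : ℕ :=
  ⨅ L : LinearOrder V, Finset.univ.sup fun v : V => (G.sreach L r v).ncard

end SimpleGraph

/-! Put q = ⌈d/4⌉, so that 3q + 1 ≤ d. The witness is the s-fold blow-up (vertices replaced by
independent sets of s copies) of a graph W without 4-cycles. For r ≥ 2, W is the (r-1)-subdivision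
of K_{N,N} with N = q^r (`webGraph`); for r = 1 it is a cover of K_{q,q} (`coverGraph`).

Colouring number: for any order, let v be the largest copy of a branch vertex. N paths of length r,
disjoint apart from their start, lead from v to branch vertices, all of whose copies are below v. On
each path, the first vertex whose copies all lie below v contributes s reachable vertices, so scol_r
≥ q^r s (`IsFanSystem.le_scol`). Biclique number: in a K_{t,t} with t > s, each side meets two
vertices of W, which gives a 4-cycle (`bicliqueNumber_blowUp`).

Twin-width, r ≥ 2: branch vertices are words of length r over q letters. The paths are folded, one
source at a time, into a butterfly network whose layer j remembers the source letters from position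
j on and the first j target letters (`uniteLabel_chain`). Forgetting the source letters turns it
into a q-ary tree (`sourceLabel_chain`), which is folded into its root (`targetLabel_chain`). Only
one source is in transition at a time, which keeps red degrees at most 3q + 1. By
`reflTransGen_ker_comap` only the labellings at the two ends of each stage need to be inspected, not
the single contractions. -/

namespace SimpleGraph

/-! ### Quotient trigraphs and chains of contractions -/

section QuotientTrigraph

variable {V : Type*} [Fintype V] [DecidableEq V]

open Classical in
/-- The class of `x` with respect to an equivalence relation, as a finset. -/
noncomputable def classOf (S : Setoid V) (x : V) : Finset V :=
  Finset.univ.filter fun y => S x y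

lemma mem_classOf {S : Setoid V} {x y : V} : y ∈ classOf S x ↔ S x y := by
  simp [classOf]

lemma classOf_eq_iff {S : Setoid V} {x y : V} : classOf S x = classOf S y ↔ S x y := by
  constructor
  · intro h
    rw [← mem_classOf, h, mem_classOf]
  · intro h
    ext z
    rw [mem_classOf, mem_classOf]
    exact ⟨fun hz => S.trans (S.symm h) hz, fun hz => S.trans h hz⟩

open Classical in
/-- The partition into the classes of an equivalence relation. -/
noncomputable def classPartition (S : Setoid V) : Finpartition (Finset.univ : Finset V) :=
  Finpartition.ofSetoid S

lemma mem_classPartition {S : Setoid V} {X : Finset V} :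
    X ∈ (classPartition S).parts ↔ ∃ x, classOf S x = X := by
  classical
  have key : ∀ x, classOf S x = (classPartition S).part x := by
    intro x
    ext y
    rw [mem_classOf, classPartition, Finpartition.mem_part_ofSetoid_iff_rel]
  constructor
  · intro hX
    obtain ⟨x, hx⟩ := (classPartition S).nonempty_of_mem_parts hX
    exact ⟨x, by rw [key]; exact (classPartition S).part_eq_of_mem hX hx⟩
  · rintro ⟨x, rfl⟩
    rw [key]
    exact (classPartition S).part_mem.2 (Finset.mem_univ x)

/-- The trigraph on the classes of an equivalence relation: complete pairs of classes are joined
by black edges, and the other pairs with an edge between them by red edges. -/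
noncomputable def quotientTrigraph (G : SimpleGraph V) (S : Setoid V) : Trigraph V where
  nodes := classPartition S
  black :=
    { Adj := fun X Y => X ∈ (classPartition S).parts ∧ Y ∈ (classPartition S).parts ∧ X ≠ Y ∧
        ∀ x ∈ X, ∀ y ∈ Y, G.Adj x y
      symm := ⟨fun _ _ h => ⟨h.2.1, h.1, h.2.2.1.symm, fun x hx y hy => (h.2.2.2 y hy x hx).symm⟩⟩
      loopless := ⟨fun _ h => h.2.2.1 rfl⟩ }
  red :=
    { Adj := fun X Y => X ∈ (classPartition S).parts ∧ Y ∈ (classPartition S).parts ∧ X ≠ Y ∧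
        (∃ x ∈ X, ∃ y ∈ Y, G.Adj x y) ∧ ¬ ∀ x ∈ X, ∀ y ∈ Y, G.Adj x y
      symm := ⟨fun _ _ ⟨hX, hY, hne, ⟨x, hx, y, hy, h⟩, hn⟩ =>
        ⟨hY, hX, hne.symm, ⟨y, hy, x, hx, h.symm⟩,
          fun hall => hn fun x hx y hy => (hall y hy x hx).symm⟩⟩
      loopless := ⟨fun _ h => h.2.2.1 rfl⟩ }
  mem_nodes_of_black := fun h => h.1
  mem_nodes_of_red := fun h => h.1
  exclusive := fun h h' => h'.2.2.2.2 h.2.2.2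

lemma quotientTrigraph_adj {G : SimpleGraph V} {S : Setoid V} {X Y : Finset V} :
    (quotientTrigraph G S).Adj X Y ↔ X ∈ (classPartition S).parts ∧
      Y ∈ (classPartition S).parts ∧ X ≠ Y ∧ ∃ x ∈ X, ∃ y ∈ Y, G.Adj x y := by
  constructor
  · rintro (⟨hX, hY, hne, h⟩ | ⟨hX, hY, hne, h, -⟩)
    · obtain ⟨x, hx⟩ := (classPartition S).nonempty_of_mem_parts hX
      obtain ⟨y, hy⟩ := (classPartition S).nonempty_of_mem_parts hY
      exact ⟨hX, hY, hne, x, hx, y, hy, h x hx y hy⟩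
    · exact ⟨hX, hY, hne, h⟩
  · rintro ⟨hX, hY, hne, h⟩
    by_cases hall : ∀ x ∈ X, ∀ y ∈ Y, G.Adj x y
    · exact Or.inl ⟨hX, hY, hne, hall⟩
    · exact Or.inr ⟨hX, hY, hne, h, hall⟩

lemma classOf_bot (x : V) : classOf (⊥ : Setoid V) x = {x} := by
  ext y
  rw [mem_classOf, Finset.mem_singleton]
  exact eq_comm

lemma quotientTrigraph_bot (G : SimpleGraph V) :
    quotientTrigraph G ⊥ = Trigraph.ofGraph G := by
  have hP : classPartition (⊥ : Setoid V) = ⊥ := by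
    ext X
    rw [mem_classPartition, Finpartition.mem_bot_iff]
    simp [classOf_bot]
  unfold quotientTrigraph Trigraph.ofGraph
  congr 1
  · ext X Y
    simp only [hP, Finpartition.mem_bot_iff]
    constructor
    · rintro ⟨⟨x, -, rfl⟩, ⟨y, -, rfl⟩, -, h⟩
      exact ⟨x, y, h x (by simp) y (by simp), rfl, rfl⟩
    · rintro ⟨x, y, h, rfl, rfl⟩
      exact ⟨⟨x, by simp⟩, ⟨y, by simp⟩, by simpa using h.ne, by simpa using h⟩
  · ext X Y
    simp only [hP, Finpartition.mem_bot_iff]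
    constructor
    · rintro ⟨⟨x, -, rfl⟩, ⟨y, -, rfl⟩, -, h, h'⟩
      exact h' (by simpa using h)
    · intro h
      exact h.elim

/-- `S'` arises from `S` by uniting the distinct classes of `x` and `y`. -/
structure IsMerge (S S' : Setoid V) (x y : V) : Prop where
  not_rel : ¬ S x y
  rel_iff : ∀ u v, S' u v ↔ S u v ∨ (S u x ∧ S v y) ∨ (S u y ∧ S v x)

lemma exists_isMerge (S : Setoid V) {x y : V} (h : ¬ S x y) : ∃ S', IsMerge S S' x y := by
  refine ⟨⟨fun u v => S u v ∨ (S u x ∧ S v y) ∨ (S u y ∧ S v x), ?_, ?_, ?_⟩, h, fun u v => Iff.rfl⟩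
  · exact fun u => Or.inl (S.refl u)
  · rintro u v (h | h | h)
    · exact Or.inl (S.symm h)
    · exact Or.inr (Or.inr ⟨h.2, h.1⟩)
    · exact Or.inr (Or.inl ⟨h.2, h.1⟩)
  · have e := @Setoid.trans' _ S
    have sy := @Setoid.symm' _ S
    rintro u v w (h1 | h1 | h1) (h2 | h2 | h2)
    · exact Or.inl (e h1 h2)
    · exact Or.inr (Or.inl ⟨e h1 h2.1, h2.2⟩)
    · exact Or.inr (Or.inr ⟨e h1 h2.1, h2.2⟩)
    · exact Or.inr (Or.inl ⟨h1.1, e (sy h2) h1.2⟩)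
    · exact absurd (e (sy h2.1) h1.2) h
    · exact Or.inl (e h1.1 (sy h2.2))
    · exact Or.inr (Or.inr ⟨h1.1, e (sy h2) h1.2⟩)
    · exact Or.inl (e h1.1 (sy h2.2))
    · exact absurd (e (sy h1.2) h2.1) h

namespace IsMerge

variable {S S' : Setoid V} {x y : V}

lemma le (h : IsMerge S S' x y) : S ≤ S' := fun u v huv => (h.rel_iff u v).2 (Or.inl huv)

lemma classOf_left (h : IsMerge S S' x y) : classOf S' x = classOf S x ∪ classOf S y := by
  ext v
  rw [Finset.mem_union, mem_classOf, mem_classOf, mem_classOf, h.rel_iff]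
  constructor
  · rintro (h1 | h1 | h1)
    · exact Or.inl h1
    · exact Or.inr (S.symm h1.2)
    · exact absurd h1.1 h.not_rel
  · rintro (h1 | h1)
    · exact Or.inl h1
    · exact Or.inr (Or.inl ⟨S.refl x, S.symm h1⟩)

lemma classOf_other (h : IsMerge S S' x y) {z : V} (hx : ¬ S z x) (hy : ¬ S z y) :
    classOf S' z = classOf S z := by
  ext v
  rw [mem_classOf, mem_classOf, h.rel_iff]
  tauto

lemma parts_eq (h : IsMerge S S' x y) : (classPartition S').parts =
    ((classPartition S).parts \ {classOf S x, classOf S y}) ∪ {classOf S x ∪ classOf S y} := by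
  ext X
  simp only [Finset.mem_union, Finset.mem_sdiff, Finset.mem_insert, Finset.mem_singleton,
    mem_classPartition]
  constructor
  · rintro ⟨z, rfl⟩
    by_cases hx : S z x
    · right
      rw [← h.classOf_left, classOf_eq_iff]
      exact h.le hx
    · by_cases hy : S z y
      · right
        rw [← h.classOf_left, classOf_eq_iff, h.rel_iff]
        exact Or.inr (Or.inr ⟨hy, S.refl x⟩)
      · left
        rw [h.classOf_other hx hy, classOf_eq_iff, classOf_eq_iff]
        exact ⟨⟨z, rfl⟩, by tauto⟩
  · rintro (⟨⟨z, rfl⟩, hz⟩ | rfl)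
    · rw [classOf_eq_iff, classOf_eq_iff] at hz
      exact ⟨z, h.classOf_other (by tauto) (by tauto)⟩
    · exact ⟨x, h.classOf_left⟩

lemma union_notMem (h : IsMerge S S' x y) :
    classOf S x ∪ classOf S y ∉ (classPartition S).parts := by
  rw [mem_classPartition]
  rintro ⟨z, hz⟩
  have hx : S z x := by rw [← mem_classOf, hz]; simp [mem_classOf]
  have hy : S z y := by rw [← mem_classOf, hz]; simp [mem_classOf]
  exact h.not_rel (S.trans (S.symm hx) hy)

lemma card_parts (h : IsMerge S S' x y) :
    (classPartition S).parts.card = (classPartition S').parts.card + 1 := by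
  have hne : classOf S x ≠ classOf S y := fun he => h.not_rel (classOf_eq_iff.1 he)
  have hsub : {classOf S x, classOf S y} ⊆ (classPartition S).parts := by
    intro X hX
    rw [Finset.mem_insert, Finset.mem_singleton] at hX
    rw [mem_classPartition]
    rcases hX with rfl | rfl
    exacts [⟨x, rfl⟩, ⟨y, rfl⟩]
  rw [h.parts_eq, Finset.card_union_of_disjoint, Finset.card_singleton]
  · have h1 := Finset.card_sdiff_add_card_eq_card hsub
    rw [Finset.card_pair hne] at h1
    omega
  · rw [Finset.disjoint_singleton_right, Finset.mem_sdiff]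
    exact fun hmem => h.union_notMem hmem.1

lemma isContraction (h : IsMerge S S' x y) (G : SimpleGraph V) :
    (quotientTrigraph G S).IsContraction (quotientTrigraph G S') (classOf S x) (classOf S y) := by
  have hX : classOf S x ∈ (classPartition S).parts := mem_classPartition.2 ⟨x, rfl⟩
  have hY : classOf S y ∈ (classPartition S).parts := mem_classPartition.2 ⟨y, rfl⟩
  have hXY : classOf S x ∪ classOf S y ∈ (classPartition S').parts := by
    rw [h.parts_eq]; simp
  have hZ' : ∀ Z ∈ (classPartition S).parts \ {classOf S x, classOf S y},
      Z ∈ (classPartition S).parts ∧ Z ∈ (classPartition S').parts ∧ classOf S x ≠ Z ∧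
      classOf S y ≠ Z ∧ classOf S x ∪ classOf S y ≠ Z := by
    intro Z hZ
    refine ⟨(Finset.mem_sdiff.1 hZ).1, ?_, ?_, ?_, ?_⟩
    · rw [h.parts_eq]
      exact Finset.mem_union_left _ hZ
    · rintro rfl; simp at hZ
    · rintro rfl; simp at hZ
    · rintro rfl
      exact h.union_notMem (Finset.mem_sdiff.1 hZ).1
  refine ⟨hX, hY, fun he => h.not_rel (classOf_eq_iff.1 he), h.parts_eq, ?_, ?_, ?_, ?_⟩
  · intro Z hZ
    obtain ⟨h1, h2, h3, h4, h5⟩ := hZ' Z hZ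
    simp only [quotientTrigraph_adj, hX, hY, hXY, h1, h2, true_and, ne_eq, h3, h4, h5,
      not_false_eq_true, Finset.mem_union]
    constructor
    · rintro ⟨u, hu | hu, hh⟩
      exacts [Or.inl ⟨u, hu, hh⟩, Or.inr ⟨u, hu, hh⟩]
    · rintro (⟨u, hu, hh⟩ | ⟨u, hu, hh⟩)
      exacts [⟨u, Or.inl hu, hh⟩, ⟨u, Or.inr hu, hh⟩]
  · intro Z hZ
    obtain ⟨h1, h2, h3, h4, h5⟩ := hZ' Z hZ
    simp only [quotientTrigraph, hX, hY, hXY, h1, h2, true_and, ne_eq, h3, h4, h5,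
      not_false_eq_true, Finset.mem_union]
    constructor
    · exact fun hh => ⟨fun u hu => hh u (Or.inl hu), fun u hu => hh u (Or.inr hu)⟩
    · rintro ⟨ha, hb⟩ u (hu | hu)
      exacts [ha u hu, hb u hu]
  · intro Z hZ W hW
    obtain ⟨h1, h2, -⟩ := hZ' Z hZ
    obtain ⟨h3, h4, -⟩ := hZ' W hW
    simp only [quotientTrigraph, h1, h2, h3, h4]
  · intro Z hZ W hW
    obtain ⟨h1, h2, -⟩ := hZ' Z hZ
    obtain ⟨h3, h4, -⟩ := hZ' W hW
    simp only [quotientTrigraph, h1, h2, h3, h4]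

end IsMerge

/-- One contraction between quotients of `G` whose result is a `d`-trigraph. -/
def QuotientStep (G : SimpleGraph V) (d : ℕ) (S S' : Setoid V) : Prop :=
  (quotientTrigraph G S').IsDTrigraph d ∧ ∃ x y, IsMerge S S' x y

/-- Merging two classes that lie in one class of `S'` stays between `S` and `S'`, so the merges may
be done in any order; the number of classes drops each time. -/
lemma reflTransGen_quotientStep (G : SimpleGraph V) (d : ℕ) {S S' : Setoid V} (hle : S ≤ S')
    (hgood : ∀ R, S ≤ R → R ≤ S' → (quotientTrigraph G R).IsDTrigraph d) :
    Relation.ReflTransGen (QuotientStep G d) S S' := by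
  induction hn : (classPartition S).parts.card using Nat.strong_induction_on generalizing S with
  | _ n ih =>
    by_cases heq : S' ≤ S
    · rw [le_antisymm hle heq]
    · have : ∃ x y, S' x y ∧ ¬ S x y := by
        by_contra! hcon
        exact heq fun x y hxy => hcon x y hxy
      obtain ⟨x, y, hxy, hnot⟩ := this
      obtain ⟨S₁, hS₁⟩ := exists_isMerge S hnot
      have hle₁ : S₁ ≤ S' := by
        intro u v huv
        rcases (hS₁.rel_iff u v).1 huv with h | h | h
        · exact hle h
        · exact S'.trans (S'.trans (hle h.1) hxy) (S'.symm (hle h.2))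
        · exact S'.trans (S'.trans (hle h.1) (S'.symm hxy)) (S'.symm (hle h.2))
      refine Relation.ReflTransGen.head ⟨hgood _ hS₁.le hle₁, x, y, hS₁⟩
        (ih _ ?_ hle₁ (fun R h1 h2 => hgood R (hS₁.le.trans h1) h2) rfl)
      have := hS₁.card_parts
      omega

/-- Every red neighbour of a class of `R` contains an endpoint of an edge from that class, with
`f`-label in `F`. Fibres of `f` lie inside classes of `R`, so distinct red neighbours get distinct
labels. Completely joined fibres of `f'` yield only black edges. -/
lemma isDTrigraph_quotientTrigraph (G : SimpleGraph V) (d : ℕ) {C C' : Type*} (f : V → C)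
    (f' : V → C') {R : Setoid V} (h1 : Setoid.ker f ≤ R) (h2 : R ≤ Setoid.ker f')
    (hF : ∀ x, ∃ F : Finset C, F.card ≤ d ∧ ∀ x' y, f' x' = f' x → G.Adj x' y →
      (¬ ∀ u v, f' u = f' x → f' v = f' y → G.Adj u v) → f y ∈ F) :
    (quotientTrigraph G R).IsDTrigraph d := by
  classical
  intro X hX
  obtain ⟨x, rfl⟩ := mem_classPartition.1 hX
  obtain ⟨F, hcard, hmem⟩ := hF x
  refine le_trans ?_ hcard
  have hsel : ∀ Z : Finset V, ∃ y, Z ∈ (quotientTrigraph G R).red.neighborSet (classOf R x) →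
      Z = classOf R y ∧ f y ∈ F := by
    intro Z
    by_cases hZ : Z ∈ (quotientTrigraph G R).red.neighborSet (classOf R x)
    · obtain ⟨-, hZp, -, ⟨x', hx', y, hy, hadj⟩, hnot⟩ := hZ
      obtain ⟨z, rfl⟩ := mem_classPartition.1 hZp
      rw [mem_classOf] at hx' hy
      refine ⟨y, fun _ => ⟨classOf_eq_iff.2 hy, hmem x' y ?_ hadj ?_⟩⟩
      · exact (h2 hx').symm
      · intro hall
        refine hnot fun u hu v hv => hall u v ?_ ?_
        · exact (h2 (mem_classOf.1 hu)).symm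
        · exact h2 (R.trans (R.symm (mem_classOf.1 hv)) hy)
    · exact ⟨x, fun h => absurd h hZ⟩
  choose g hg using hsel
  rw [← Set.ncard_coe_finset F]
  refine Set.ncard_le_ncard_of_injOn (fun Z => f (g Z)) (fun Z hZ => (hg Z hZ).2) ?_
    F.finite_toSet
  intro Z hZ W hW hZW
  rw [(hg Z hZ).1, (hg W hW).1, classOf_eq_iff]
  exact h1 hZW

/-- The quotients of a pullback of `G` by the fibres of `f` and of `f'` are joined by contractions
through `d`-trigraphs, if the number of fibres of `f` that are seen by a fibre of `f'` is at most
`d`; fibres lying in a fibre of `f'` that is completely joined to the given one do not count. -/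
lemma reflTransGen_ker_comap {W : Type*} (G : SimpleGraph W) (p : V → W) (d : ℕ) {C C' : Type*}
    (f : W → C) (f' : W → C') (hff : ∀ x y, f x = f y → f' x = f' y)
    (hF : ∀ x, ∃ F : Finset C, F.card ≤ d ∧ ∀ x' y, f' x' = f' x → G.Adj x' y →
      (¬ ∀ u v, f' u = f' x → f' v = f' y → G.Adj u v) → f y ∈ F) :
    Relation.ReflTransGen (QuotientStep (G.comap p) d)
      (Setoid.ker (f ∘ p)) (Setoid.ker (f' ∘ p)) := by
  refine reflTransGen_quotientStep _ d (fun x y h => hff (p x) (p y) h) fun _ h1 h2 =>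
    isDTrigraph_quotientTrigraph _ d (f ∘ p) (f' ∘ p) h1 h2 fun x => ?_
  obtain ⟨F, hF1, hF2⟩ := hF (p x)
  exact ⟨F, hF1, fun x' y hx' hxy hnot => hF2 (p x') (p y) hx' hxy
    fun hall => hnot fun u v hu hv => hall (p u) (p v) hu hv⟩

/-- Vertices in one fibre of `p` are twins, so uniting them creates no red edge and any `d` will do.
-/
lemma reflTransGen_bot_ker_comap {W : Type*} (G : SimpleGraph W) (p : V → W) (d : ℕ) :
    Relation.ReflTransGen (QuotientStep (G.comap p) d) ⊥ (Setoid.ker p) := by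
  have hb : (⊥ : Setoid V) = Setoid.ker (id : V → V) := by
    ext x y
    exact Iff.rfl
  rw [hb]
  refine reflTransGen_quotientStep _ d (fun x y h => congrArg p h) fun _ h1 h2 =>
    isDTrigraph_quotientTrigraph _ d id p h1 h2 fun x => ⟨∅, by simp, ?_⟩
  intro x' y hx' hxy hnot
  refine absurd (fun u v hu hv => ?_) hnot
  rw [comap_adj] at hxy ⊢
  rwa [hu, hv, ← hx']

lemma isDTrigraph_ofGraph (G : SimpleGraph V) (d : ℕ) : (Trigraph.ofGraph G).IsDTrigraph d := by
  intro X _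
  have : (Trigraph.ofGraph G).red.neighborSet X = ∅ := by
    ext Y
    exact ⟨fun h => h.elim, fun h => h.elim⟩
  rw [this]
  simp

/-- The trigraph with index i is the one with i classes; every merge lowers the index by one. -/
lemma hasContractionSequence_of_reflTransGen [Nonempty V] (G : SimpleGraph V) (d : ℕ)
    (h : Relation.ReflTransGen (QuotientStep G d) ⊥ ⊤) : G.HasContractionSequence d := by
  have main : ∀ S : Setoid V, Relation.ReflTransGen (QuotientStep G d) S ⊤ →
      (quotientTrigraph G S).IsDTrigraph d → ∃ T : ℕ → Trigraph V,
      T (classPartition S).parts.card = quotientTrigraph G S ∧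
      (T 1).nodes.parts = {Finset.univ} ∧
      (∀ i, 1 ≤ i → i ≤ (classPartition S).parts.card → (T i).IsDTrigraph d) ∧
      (∀ i, 1 ≤ i → i < (classPartition S).parts.card →
        ∃ X Y, (T (i + 1)).IsContraction (T i) X Y) := by
    intro S hS
    induction hS using Relation.ReflTransGen.head_induction_on with
    | refl =>
      intro hd
      have hP : (classPartition (⊤ : Setoid V)).parts = {Finset.univ} := by
        ext X
        rw [mem_classPartition, Finset.mem_singleton]
        have hc : ∀ x, classOf (⊤ : Setoid V) x = Finset.univ := by
          intro x
          ext y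
          simp [mem_classOf]
        simp [hc, eq_comm]
      refine ⟨fun _ => quotientTrigraph G ⊤, rfl, hP, fun _ _ _ => hd, ?_⟩
      intro i h1 h2
      rw [hP, Finset.card_singleton] at h2
      omega
    | @head S S₁ hstep _ ih =>
      intro hd
      obtain ⟨hd₁, x, y, hm⟩ := hstep
      obtain ⟨T, hT1, hT2, hT3, hT4⟩ := ih hd₁
      have hc := hm.card_parts
      have hpos : 1 ≤ (classPartition S₁).parts.card := by
        rw [Nat.one_le_iff_ne_zero, Finset.card_ne_zero]
        exact ⟨_, mem_classPartition.2 ⟨x, rfl⟩⟩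
      set n := (classPartition S₁).parts.card with hn
      rw [hc]
      refine ⟨Function.update T (n + 1) (quotientTrigraph G S), by simp, ?_, ?_, ?_⟩
      · rw [Function.update_of_ne (by omega)]
        exact hT2
      · intro i h1 h2
        rcases eq_or_ne i (n + 1) with rfl | hi
        · simpa using hd
        · rw [Function.update_of_ne hi]
          exact hT3 i h1 (by omega)
      · intro i h1 h2
        rw [Function.update_of_ne (a := i) (by omega)]
        rcases eq_or_ne i n with rfl | hi
        · rw [Function.update_self, hT1]
          exact ⟨_, _, hm.isContraction G⟩
        · rw [Function.update_of_ne (by omega)]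
          exact hT4 i h1 (by omega)
  have hbot := quotientTrigraph_bot G
  obtain ⟨T, hT⟩ := main ⊥ h (by rw [hbot]; exact isDTrigraph_ofGraph G d)
  have hcard : (classPartition (⊥ : Setoid V)).parts.card = Fintype.card V := by
    have : classPartition (⊥ : Setoid V) = ⊥ := congrArg Trigraph.nodes hbot
    rw [this, Finpartition.card_bot, Finset.card_univ]
  rw [hcard, hbot] at hT
  exact ⟨T, hT⟩

end QuotientTrigraph


/-! ### Fans of paths and the strong colouring number of a blow-up -/

lemma exists_isPath_of_seq {V : Type*} (G : SimpleGraph V) (q : ℕ → V) (n : ℕ)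
    (hadj : ∀ j < n, G.Adj (q j) (q (j + 1)))
    (hinj : ∀ i ≤ n, ∀ j ≤ n, q i = q j → i = j) :
    ∃ p : G.Walk (q 0) (q n), p.IsPath ∧ p.length = n ∧ ∀ w ∈ p.support, ∃ j ≤ n, w = q j := by
  induction n with
  | zero => exact ⟨Walk.nil, by simp, rfl, fun w hw => ⟨0, le_rfl, by simpa using hw⟩⟩
  | succ n ih =>
    obtain ⟨p, hp, hlen, hsup⟩ := ih (fun j hj => hadj j (by omega))
      (fun i hi j hj => hinj i (by omega) j (by omega))
    have hadjn := hadj n (by omega)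
    refine ⟨p.concat hadjn, hp.concat ?_ hadjn, by simp [hlen], ?_⟩
    · intro hmem
      obtain ⟨j, hj, hjq⟩ := hsup _ hmem
      have := hinj (n + 1) le_rfl j (by omega) hjq
      omega
    · intro w hw
      rw [Walk.support_concat, List.mem_append, List.mem_singleton] at hw
      rcases hw with hw | rfl
      · obtain ⟨j, hj, rfl⟩ := hsup _ hw
        exact ⟨j, by omega, rfl⟩
      · exact ⟨n + 1, le_rfl, rfl⟩

/-- The graph obtained from `G` by replacing each vertex by `s` pairwise non-adjacent copies. -/
abbrev blowUp {W : Type*} (G : SimpleGraph W) (s : ℕ) : SimpleGraph (W × Fin s) :=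
  G.comap Prod.fst

/-- Each vertex `v` of `B` has a fan of paths `p v c` of length `r`, disjoint apart from `v`, that
end in other vertices of `B`. -/
structure IsFanSystem {W C : Type*} (G : SimpleGraph W) (r : ℕ) (B : Set W)
    (p : W → C → ℕ → W) : Prop where
  zero : ∀ v ∈ B, ∀ c, p v c 0 = v
  adj : ∀ v ∈ B, ∀ c, ∀ i < r, G.Adj (p v c i) (p v c (i + 1))
  mem : ∀ v ∈ B, ∀ c, p v c r ∈ B
  inj : ∀ v ∈ B, ∀ c c' i i', 1 ≤ i → i ≤ r → 1 ≤ i' → i' ≤ r → p v c i = p v c' i' →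
    c = c' ∧ i = i'
  ne : ∀ v ∈ B, ∀ c i, 1 ≤ i → i ≤ r → p v c i ≠ v

lemma IsFanSystem.le_ncard_sreach {W C : Type*} [Fintype W] [Fintype C] {G : SimpleGraph W}
    {r s : ℕ} {B : Set W} {p : W → C → ℕ → W} (h : IsFanSystem G r B p) (hr : 1 ≤ r)
    (hs : 1 ≤ s) (hB : B.Nonempty) (L : LinearOrder (W × Fin s)) :
    ∃ v, Fintype.card C * s ≤ ((G.blowUp s).sreach L r v).ncard := by
  classical
  -- The largest copy of a vertex of `B`: all ends of its fan lie below it.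
  have hmax : ∃ v : W × Fin s, v.1 ∈ B ∧ ∀ w : W × Fin s, w.1 ∈ B → L.le w v := by
    obtain ⟨b, hb⟩ := hB
    obtain ⟨v, hv, hm⟩ := @Finset.exists_max_image (W × Fin s) (W × Fin s) L
      (Finset.univ.filter fun w => w.1 ∈ B) id ⟨(b, ⟨0, hs⟩), by simpa using hb⟩
    exact ⟨v, by simpa using hv, fun w hw => hm w (by simpa using hw)⟩
  obtain ⟨v, hv, hm⟩ := hmax
  have hlt : ∀ w, w ≠ v → ¬ L.lt w v → L.lt v w := fun w h1 h2 =>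
    (@lt_or_gt_of_ne _ L w v h1).resolve_left h2
  -- Some vertex of each path has all its copies below `v`; the end of the path is one. The first
  -- such index is used below.
  have hex : ∀ c, ∃ i, 1 ≤ i ∧ i ≤ r ∧ ∀ t, L.lt (p v.1 c i, t) v := by
    refine fun c => ⟨r, hr, le_rfl, fun t => ?_⟩
    refine @lt_of_le_of_ne _ L.toPartialOrder _ _ (hm _ (h.mem v.1 hv c)) fun he => ?_
    exact h.ne v.1 hv c r hr le_rfl (congrArg Prod.fst he)
  have hreach : ∀ c t, (p v.1 c (Nat.find (hex c)), t) ∈ (G.blowUp s).sreach L r v := by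
    intro c t
    obtain ⟨hi1, hir, hil⟩ := Nat.find_spec (hex c)
    have hmin := fun m => @Nat.find_min _ _ (hex c) m
    generalize Nat.find (hex c) = i at hi1 hir hil hmin
    -- By minimality of `i`, every earlier inner vertex has a copy above `v`, through which the path
    -- can be routed.
    have hcopy : ∀ j, ∃ u : Fin s, 1 ≤ j → j < i → L.lt v (p v.1 c j, u) := by
      intro j
      by_cases hj : 1 ≤ j ∧ j < i
      · have := hmin j hj.2
        push Not at this
        obtain ⟨u, hu⟩ := this hj.1 (by omega)
        refine ⟨u, fun _ _ => hlt _ (fun he => ?_) (@not_lt_of_ge _ L.toPreorder _ _ hu)⟩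
        exact h.ne v.1 hv c j hj.1 (by omega) (congrArg Prod.fst he)
      · exact ⟨⟨0, hs⟩, fun h1 h2 => absurd ⟨h1, h2⟩ hj⟩
    choose u hu using hcopy
    set q : ℕ → W × Fin s := fun j =>
      (p v.1 c j, if j = 0 then v.2 else if j = i then t else u j) with hq
    have hq0 : q 0 = v := by simp [hq, h.zero v.1 hv c]
    have hqi : q i = (p v.1 c i, t) := by
      simp [hq, show i ≠ 0 by omega]
    have hfst : ∀ a b, q a = q b → p v.1 c a = p v.1 c b := fun a b hab =>
      congrArg Prod.fst hab
    obtain ⟨w, hw1, hw2, hw3⟩ := exists_isPath_of_seq (G.blowUp s) q i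
      (fun j hj => h.adj v.1 hv c j (by omega))
      (by
        intro a ha b hb hab
        have hab' := hfst a b hab
        rcases Nat.eq_zero_or_pos a with rfl | ha0
        · rcases Nat.eq_zero_or_pos b with rfl | hb0
          · rfl
          · rw [h.zero v.1 hv c] at hab'
            exact absurd hab'.symm (h.ne v.1 hv c b hb0 (by omega))
        · rcases Nat.eq_zero_or_pos b with rfl | hb0
          · rw [h.zero v.1 hv c] at hab'
            exact absurd hab' (h.ne v.1 hv c a ha0 (by omega))
          · exact (h.inj v.1 hv c c a b ha0 (by omega) hb0 (by omega) hab').2)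
    rw [← hqi]
    refine ⟨?_, ?_⟩
    · rw [hqi]
      exact @le_of_lt _ L.toPreorder _ _ (hil t)
    · rw [← hq0]
      refine ⟨w, hw1, by omega, fun z hz hz1 hz2 => ?_⟩
      obtain ⟨j, hj, rfl⟩ := hw3 z hz
      have hj0 : j ≠ 0 := by rintro rfl; exact hz1 rfl
      have hji : j ≠ i := by rintro rfl; exact hz2 rfl
      rw [hq0]
      simp only [hq, hj0, hji, if_false]
      exact hu j (by omega) (by omega)
  refine ⟨v, ?_⟩
  set φ : C × Fin s → W × Fin s := fun x => (p v.1 x.1 (Nat.find (hex x.1)), x.2) with hφ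
  have hφi : Function.Injective φ := by
    rintro ⟨c, t⟩ ⟨c', t'⟩ he
    simp only [hφ, Prod.mk.injEq] at he
    obtain ⟨h1, h2, -⟩ := Nat.find_spec (hex c)
    obtain ⟨h1', h2', -⟩ := Nat.find_spec (hex c')
    rw [(h.inj v.1 hv c c' _ _ h1 h2 h1' h2' he.1).1, he.2]
  calc Fintype.card C * s = (Finset.univ.image φ).card := by
        rw [Finset.card_image_of_injective _ hφi, Finset.card_univ, Fintype.card_prod,
          Fintype.card_fin]
    _ ≤ _ := by
        rw [← Set.ncard_coe_finset]
        refine Set.ncard_le_ncard ?_ (Set.toFinite _)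
        intro x hx
        obtain ⟨y, -, rfl⟩ := Finset.mem_image.1 hx
        exact hreach y.1 y.2

lemma IsFanSystem.le_scol {W C : Type*} [Fintype W] [Fintype C] {G : SimpleGraph W}
    {r s : ℕ} {B : Set W} {p : W → C → ℕ → W} (h : IsFanSystem G r B p) (hr : 1 ≤ r)
    (hs : 1 ≤ s) (hB : B.Nonempty) : Fintype.card C * s ≤ (G.blowUp s).scol r := by
  have : Nonempty (LinearOrder (W × Fin s)) :=
    ⟨LinearOrder.lift' (Fintype.equivFin _) (Fintype.equivFin _).injective⟩
  refine le_ciInf fun L => ?_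
  obtain ⟨v, hv⟩ := h.le_ncard_sreach hr hs hB L
  exact hv.trans (Finset.le_sup (f := fun v => ((G.blowUp s).sreach L r v).ncard)
    (Finset.mem_univ v))

/-! ### Bicliques in a blow-up -/

/-- Two distinct vertices never have two distinct common neighbours. -/
def HasNoFourCycle {W : Type*} (G : SimpleGraph W) : Prop :=
  ∀ x x' y y', x ≠ x' → G.Adj x y → G.Adj x' y → G.Adj x y' → G.Adj x' y' → y = y'

lemma exists_fst_ne {W : Type*} {s t : ℕ} (hst : s < t) (φ : Fin t → W × Fin s)
    (hφ : Function.Injective φ) : ∃ i j, (φ i).1 ≠ (φ j).1 := by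
  by_contra! hcon
  have : Function.Injective fun i => (φ i).2 :=
    fun i j hij => hφ (Prod.ext (hcon i j) hij)
  have := Fintype.card_le_of_injective _ this
  simp at this
  omega

/-- An edge blows up to K_{s,s}. With more than `s` vertices on a side, two of them are copies of
different vertices; doing this on both sides gives a 4-cycle below. -/
lemma bicliqueNumber_blowUp {W : Type*} [Fintype W] {G : SimpleGraph W} (h : HasNoFourCycle G)
    {u v : W} (huv : G.Adj u v) (s : ℕ) : (G.blowUp s).bicliqueNumber = s := by
  refine IsGreatest.csSup_eq ⟨⟨⟨⟨Sum.elim (fun i => (u, i)) (fun i => (v, i)), ?_⟩, ?_⟩⟩, ?_⟩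
  · rintro (i | i) (j | j) hij
    · simp at hij
    · exact huv
    · exact huv.symm
    · simp at hij
  · rintro (i | i) (j | j) hij
    · simpa using hij
    · exact absurd (congrArg Prod.fst hij) huv.ne
    · exact absurd (congrArg Prod.fst hij) huv.ne'
    · simpa using hij
  · rintro t ⟨φ⟩
    by_contra! hst
    obtain ⟨i, i', hi⟩ := exists_fst_ne hst (fun i => φ (Sum.inl i))
      (fun a b hab => Sum.inl_injective (φ.injective hab))
    obtain ⟨j, j', hj⟩ := exists_fst_ne hst (fun i => φ (Sum.inr i))
      (fun a b hab => Sum.inr_injective (φ.injective hab))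
    have hadj : ∀ a b, G.Adj (φ (Sum.inl a)).1 (φ (Sum.inr b)).1 := fun a b =>
      φ.toHom.map_adj (by simp)
    exact hj (h _ _ _ _ hi (hadj i j) (hadj i' j) (hadj i j') (hadj i' j'))


/-! ### The case r = 1: a 4-cycle-free cover of K_{q,q} -/

/-- The pair of indices of a `true` and a `false` vertex. -/
def biIndex {q : ℕ} (σ : Bool) (i j : Fin q) : Fin q × Fin q := if σ then (i, j) else (j, i)

/-- The cover of `K_{q,q}` with fibre `𝔽₂ ^ (q × q)` in which the edge `e` translates by the basis
vector of `e`. -/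
def coverGraph (q : ℕ) : SimpleGraph (Bool × Fin q × (Fin q × Fin q → Bool)) where
  Adj x y := x.1 = (!y.1) ∧ ∀ e, x.2.2 e = xor (y.2.2 e) (decide (e = biIndex x.1 x.2.1 y.2.1))
  symm := ⟨by
    rintro ⟨σ, i, g⟩ ⟨τ, j, h⟩ ⟨rfl, hgh⟩
    refine ⟨by simp, fun e => ?_⟩
    have h1 := hgh e
    have h2 : biIndex τ j i = biIndex (!τ) i j := by cases τ <;> rfl
    simp only at h1 ⊢
    rw [h1, h2]
    simp⟩
  loopless := ⟨by
    rintro ⟨σ, i, g⟩ ⟨h, -⟩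
    simp at h⟩

lemma coverGraph_adj {q : ℕ} {x y : Bool × Fin q × (Fin q × Fin q → Bool)} :
    (coverGraph q).Adj x y ↔ x.1 = (!y.1) ∧
      ∀ e, x.2.2 e = xor (y.2.2 e) (decide (e = biIndex x.1 x.2.1 y.2.1)) := Iff.rfl

lemma biIndex_inj {q : ℕ} {σ : Bool} {i j i' j' : Fin q} :
    biIndex σ i j = biIndex σ i' j' ↔ i = i' ∧ j = j' := by
  cases σ <;> simp [biIndex, and_comm]

/-- A 4-cycle would project to i, j, i', j' in K_{q,q}. If i = i' or j = j' it degenerates;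
otherwise the total translation is a sum of four distinct basis vectors, which is not zero. -/
lemma hasNoFourCycle_coverGraph (q : ℕ) : HasNoFourCycle (coverGraph q) := by
  rintro ⟨σ, i, g⟩ ⟨σ', i', g'⟩ ⟨τ, j, h⟩ ⟨τ', j', h'⟩ hne h1 h2 h3 h4
  simp only [coverGraph_adj] at h1 h2 h3 h4
  obtain ⟨h1a, h1⟩ := h1
  obtain ⟨h2a, h2⟩ := h2
  obtain ⟨h3a, h3⟩ := h3
  obtain ⟨h4a, h4⟩ := h4
  obtain rfl : τ = τ' := by rw [h1a] at h3a; simpa using h3a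
  subst h1a
  subst h2a
  by_cases hi : i = i'
  · subst hi
    refine absurd ?_ hne
    congr 2
    ext e
    rw [h1, h2]
  · by_cases hj : j = j'
    · subst hj
      congr 2
      ext e
      have e1 := h1 e
      rw [h3 e] at e1
      simpa using e1.symm
    -- Of the four edges, only the first flips the coordinate of (i, j).
    · have e1 := h1 (biIndex (!τ) i j)
      have e2 := h2 (biIndex (!τ) i j)
      have e3 := h3 (biIndex (!τ) i j)
      have e4 := h4 (biIndex (!τ) i j)
      simp only [biIndex_inj, hi, hj, and_true, and_false,
        decide_true, decide_false, Bool.xor_false, Bool.xor_true] at e1 e2 e3 e4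
      rw [e3, ← e4, e2] at e1
      simp at e1

lemma exists_coverGraph_adj {q : ℕ} (hq : 1 ≤ q) : ∃ u v, (coverGraph q).Adj u v :=
  ⟨(true, ⟨0, hq⟩, fun e => decide (e = biIndex true ⟨0, hq⟩ ⟨0, hq⟩)),
    (false, ⟨0, hq⟩, fun _ => false), by simp [coverGraph_adj]⟩

lemma isFanSystem_coverGraph (q : ℕ) :
    IsFanSystem (coverGraph q) 1 Set.univ fun v (c : Fin q) i =>
      if i = 0 then v else
        (!v.1, c, fun e => xor (v.2.2 e) (decide (e = biIndex v.1 v.2.1 c))) where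
  zero := by simp
  adj := by
    intro v _ c i hi
    obtain rfl : i = 0 := by omega
    simp [coverGraph_adj]
  mem := by simp
  inj := by
    intro v _ c c' i i' h1 h2 h3 h4 h
    obtain rfl : i = 1 := by omega
    obtain rfl : i' = 1 := by omega
    simp only [one_ne_zero, if_false, Prod.mk.injEq] at h
    exact ⟨h.2.1, rfl⟩
  ne := by
    intro v _ c i h1 h2 h
    rw [if_neg (by omega)] at h
    have := congrArg Prod.fst h
    simp at this

/-- Forget the coordinates outside `S`. -/
def coverLabel {q : ℕ} (S : Finset (Fin q × Fin q)) (x : Bool × Fin q × (Fin q × Fin q → Bool)) :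
    Bool × Fin q × (Fin q × Fin q → Bool) :=
  (x.1, x.2.1, fun e => if e ∈ S then x.2.2 e else false)

lemma coverLabel_eq_iff {q : ℕ} {S : Finset (Fin q × Fin q)}
    {x y : Bool × Fin q × (Fin q × Fin q → Bool)} : coverLabel S x = coverLabel S y ↔
      x.1 = y.1 ∧ x.2.1 = y.2.1 ∧ ∀ e ∈ S, x.2.2 e = y.2.2 e := by
  simp only [coverLabel, Prod.mk.injEq, funext_iff]
  refine and_congr_right fun _ => and_congr_right fun _ => forall_congr' fun e => ?_
  split_ifs with h <;> simp [h]

/-- Coordinates are forgotten one by one. A neighbouring class is determined by its index in K_{q,q}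
and its value at the coordinate in transition: 2q choices. -/
lemma coverGraph_forget {V : Type*} [Fintype V] [DecidableEq V] {q d : ℕ} (hd : 2 * q ≤ d)
    (p : V → Bool × Fin q × (Fin q × Fin q → Bool)) (S : Finset (Fin q × Fin q)) :
    Relation.ReflTransGen (QuotientStep ((coverGraph q).comap p) d)
      (Setoid.ker (coverLabel S ∘ p)) (Setoid.ker (coverLabel ∅ ∘ p)) := by
  induction S using Finset.induction_on with
  | empty => exact Relation.ReflTransGen.refl
  | insert e₀ S he₀ ih =>
    refine Relation.ReflTransGen.trans (reflTransGen_ker_comap _ p d _ _ ?_ ?_) ih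
    · intro x y h
      rw [coverLabel_eq_iff] at h ⊢
      exact ⟨h.1, h.2.1, fun e he => h.2.2 e (Finset.mem_insert_of_mem he)⟩
    · rintro ⟨σ, i, g⟩
      -- In the pair `c`, the first entry is the neighbour's index, the second its coordinate at
      -- `e₀`; coordinates in `S` are forced by the translation.
      refine ⟨(Finset.univ : Finset (Fin q × Bool)).image fun c => (!σ, c.1, fun e =>
        if e = e₀ then c.2 else
          if e ∈ S then xor (g e) (decide (e = biIndex σ i c.1)) else false), ?_, ?_⟩
      · refine Finset.card_image_le.trans ?_
        simp
        omega
      · rintro ⟨σ', i', g'⟩ ⟨τ, j, h⟩ hx hadj -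
        rw [coverLabel_eq_iff] at hx
        obtain ⟨rfl, rfl, hg⟩ := hx
        simp only at hg
        rw [coverGraph_adj] at hadj
        obtain ⟨h1, h2⟩ := hadj
        simp only at h1 h2
        subst h1
        refine Finset.mem_image.2 ⟨(j, h e₀), Finset.mem_univ _, ?_⟩
        simp only [coverLabel, Bool.not_not, Prod.mk.injEq, true_and]
        ext e
        by_cases hee : e = e₀
        · subst hee
          simp
        · by_cases heS : e ∈ S
          · rw [if_neg hee, if_pos heS, if_pos (Finset.mem_insert_of_mem heS), ← hg e heS, h2]
            simp
          · rw [if_neg hee, if_neg heS, if_neg (by simp [hee, heS])]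

/-- Once all coordinates are forgotten only the 2q vertices of K_{q,q} remain, and they may be
merged arbitrarily. -/
lemma coverGraph_collapse {V : Type*} [Fintype V] [DecidableEq V] {q d : ℕ} (hd : 2 * q ≤ d)
    (p : V → Bool × Fin q × (Fin q × Fin q → Bool)) :
    Relation.ReflTransGen (QuotientStep ((coverGraph q).comap p) d) ⊥ ⊤ := by
  refine (reflTransGen_bot_ker_comap _ p d).trans ?_
  have h1 : Setoid.ker p = Setoid.ker (coverLabel Finset.univ ∘ p) := by
    have : (coverLabel Finset.univ : Bool × Fin q × (Fin q × Fin q → Bool) → _) = id := by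
      ext x <;> simp [coverLabel]
    rw [this]
    rfl
  have h2 : (⊤ : Setoid V) =
      Setoid.ker ((fun _ : Bool × Fin q × (Fin q × Fin q → Bool) => ()) ∘ p) := by
    ext x y
    simp [Setoid.ker_def]
  rw [h1, h2]
  refine (coverGraph_forget hd p _).trans (reflTransGen_ker_comap _ p d _ _ (by simp) fun x => ?_)
  refine ⟨(Finset.univ : Finset (Bool × Fin q)).image fun c => (c.1, c.2, fun _ => false), ?_, ?_⟩
  · refine Finset.card_image_le.trans ?_
    simpa using hd
  · intro x' y _ _ _
    exact Finset.mem_image.2 ⟨(y.1, y.2.1), Finset.mem_univ _, by simp [coverLabel]⟩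


/-! ### Prefixes and suffixes of words -/

section Words

variable {r q : ℕ} [NeZero q]

/-- The letters of `b` before position `j`, padded by zeros. -/
def wordHead (j : ℕ) (b : Fin r → Fin q) : Fin r → Fin q := fun i => if i.val < j then b i else 0

/-- The letters of `a` from position `j` on, padded by zeros. -/
def wordTail (j : ℕ) (a : Fin r → Fin q) : Fin r → Fin q := fun i => if j ≤ i.val then a i else 0

/-- Put the letter `c` at position `j`. -/
def wordPut (j : ℕ) (b : Fin r → Fin q) (c : Fin q) : Fin r → Fin q :=
  fun i => if i.val = j then c else b i

lemma wordHead_wordHead (m n : ℕ) (b : Fin r → Fin q) :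
    wordHead m (wordHead n b) = wordHead (min m n) b := by
  ext i
  simp only [wordHead, lt_min_iff]
  split_ifs <;> simp_all

lemma wordTail_wordTail (m n : ℕ) (a : Fin r → Fin q) :
    wordTail m (wordTail n a) = wordTail (max m n) a := by
  ext i
  simp only [wordTail, max_le_iff]
  split_ifs <;> simp_all

lemma wordHead_eq_of_le {m n : ℕ} (h : m ≤ n) {b b' : Fin r → Fin q}
    (hb : wordHead n b = wordHead n b') : wordHead m b = wordHead m b' := by
  have := congrArg (wordHead m) hb
  rwa [wordHead_wordHead, wordHead_wordHead, min_eq_left h] at this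

lemma wordTail_eq_of_le {m n : ℕ} (h : n ≤ m) {a a' : Fin r → Fin q}
    (ha : wordTail n a = wordTail n a') : wordTail m a = wordTail m a' := by
  have := congrArg (wordTail m) ha
  rwa [wordTail_wordTail, wordTail_wordTail, max_eq_left h] at this

lemma wordHead_zero (b : Fin r → Fin q) : wordHead 0 b = 0 := by
  ext i; simp [wordHead]

lemma wordHead_of_le {j : ℕ} (h : r ≤ j) (b : Fin r → Fin q) : wordHead j b = b := by
  ext i
  rw [wordHead, if_pos (by omega)]

lemma wordTail_zero (a : Fin r → Fin q) : wordTail 0 a = a := by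
  ext i; simp [wordTail]

lemma wordTail_of_le {j : ℕ} (h : r ≤ j) (a : Fin r → Fin q) : wordTail j a = 0 := by
  ext i
  rw [wordTail, if_neg (by omega)]
  rfl

/-- A prefix at most one letter longer than the known one has only q candidates; the counts of
neighbouring classes rest on this. -/
lemma exists_wordHead_eq {m n : ℕ} (h : m ≤ n + 1) (b : Fin r → Fin q) :
    ∃ c, wordHead m b = wordHead m (wordPut n (wordHead n b) c) := by
  refine ⟨if hn : n < r then b ⟨n, hn⟩ else 0, ?_⟩
  ext i
  by_cases hi : i.val < m
  · by_cases hin : i.val = n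
    · subst hin
      simp [wordHead, wordPut]
    · have : i.val < n := by omega
      simp [wordHead, wordPut, hi, hin, this]
  · simp [wordHead, hi]

lemma exists_wordTail_eq {m n : ℕ} (h : n ≤ m + 1) (a : Fin r → Fin q) :
    ∃ c, wordTail m a = wordTail m (wordPut (n - 1) (wordTail n a) c) := by
  refine ⟨if hn : n - 1 < r then a ⟨n - 1, hn⟩ else 0, ?_⟩
  ext i
  by_cases hi : m ≤ i.val
  · by_cases hin : i.val = n - 1
    · simp [wordTail, wordPut, ← hin]
    · have : n ≤ i.val := by omega
      simp [wordTail, wordPut, hi, hin, this]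
  · simp [wordTail, hi]

end Words

/-! ### The subdivided complete bipartite graph, for r ≥ 2 -/

/-- The vertices of the paths of length `r` that join any two words `a` and `b` of length `r`:
a vertex is given by its distance from the source `a`, and by `a` and `b`; the target is
disregarded at the source, and the source at the target. -/
abbrev WebVertex (r q : ℕ) [NeZero q] : Type :=
  {x : Fin (r + 1) × (Fin r → Fin q) × (Fin r → Fin q) //
    (x.1.val = 0 → x.2.2 = 0) ∧ (x.1.val = r → x.2.1 = 0)}

namespace WebVertex

variable {r q : ℕ} [NeZero q]

/-- The distance from the source. -/
def layer (x : WebVertex r q) : ℕ := x.1.1.val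

/-- The source word. -/
def src (x : WebVertex r q) : Fin r → Fin q := x.1.2.1

/-- The target word. -/
def tgt (x : WebVertex r q) : Fin r → Fin q := x.1.2.2

lemma layer_le (x : WebVertex r q) : x.layer ≤ r := Nat.lt_succ_iff.1 x.1.1.2

lemma tgt_eq_zero {x : WebVertex r q} (h : x.layer = 0) : x.tgt = 0 := x.2.1 h

lemma src_eq_zero {x : WebVertex r q} (h : x.layer = r) : x.src = 0 := x.2.2 h

lemma ext_iff' {x y : WebVertex r q} :
    x = y ↔ x.layer = y.layer ∧ x.src = y.src ∧ x.tgt = y.tgt := by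
  rw [Subtype.ext_iff, Prod.ext_iff, Prod.ext_iff, Fin.ext_iff]
  rfl

/-- The vertex at distance `j` from `a` on the path from `a` to `b`. -/
def ofPath (j : ℕ) (a b : Fin r → Fin q) : WebVertex r q :=
  ⟨(⟨min j r, by omega⟩, if r ≤ j then 0 else a, if j = 0 then 0 else b), by
    constructor
    · intro h
      by_cases hj : j = 0
      · simp [hj]
      · have hr : r = 0 := by simp only at h; omega
        subst hr
        exact Subsingleton.elim _ _
    · intro h
      rw [if_pos (by simp only at h; omega)]⟩

@[simp] lemma layer_ofPath (j : ℕ) (a b : Fin r → Fin q) : (ofPath j a b).layer = min j r := rfl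

@[simp] lemma src_ofPath (j : ℕ) (a b : Fin r → Fin q) :
    (ofPath j a b).src = if r ≤ j then 0 else a := rfl

@[simp] lemma tgt_ofPath (j : ℕ) (a b : Fin r → Fin q) :
    (ofPath j a b).tgt = if j = 0 then 0 else b := rfl

/-- `y` follows `x` on some path. -/
def Next (x y : WebVertex r q) : Prop :=
  y.layer = x.layer + 1 ∧ (x.layer ≠ 0 → x.tgt = y.tgt) ∧ (y.layer ≠ r → x.src = y.src)

lemma Next.wordHead_eq {x y : WebVertex r q} (h : Next x y) :
    wordHead x.layer x.tgt = wordHead x.layer y.tgt := by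
  by_cases h0 : x.layer = 0
  · rw [h0, wordHead_zero, wordHead_zero]
  · rw [h.2.1 h0]

lemma Next.wordTail_eq {x y : WebVertex r q} (h : Next x y) :
    wordTail y.layer x.src = wordTail y.layer y.src := by
  by_cases h0 : y.layer = r
  · rw [wordTail_of_le h0.ge, wordTail_of_le h0.ge]
  · rw [h.2.2 h0]

end WebVertex

open WebVertex

/-- The graph of the paths of length `r` joining any two words of length `r`: the
`(r - 1)`-subdivision of a complete bipartite graph. -/
def webGraph (r q : ℕ) [NeZero q] : SimpleGraph (WebVertex r q) where
  Adj x y := Next x y ∨ Next y x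
  symm := ⟨fun _ _ h => h.symm⟩
  loopless := ⟨fun x h => by
    rcases h with h | h <;> exact absurd h.1 (by omega)⟩

section WebGraph

variable {r q : ℕ} [NeZero q]

/-- An edge keeps the target unless it leaves layer 0 and the source unless it enters layer `r`. For
r ≥ 2 no edge does both, unlike for r = 1, where the graph is complete bipartite. -/
lemma hasNoFourCycle_webGraph (hr : 2 ≤ r) : HasNoFourCycle (webGraph r q) := by
  intro x x' y y' hne h1 h2 h3 h4
  rw [Ne, ext_iff'] at hne
  rw [ext_iff']
  have hx := x.layer_le
  have hx' := x'.layer_le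
  have hy := y.layer_le
  have hy' := y'.layer_le
  have tx := @tgt_eq_zero _ _ _ x
  have tx' := @tgt_eq_zero _ _ _ x'
  have ty := @tgt_eq_zero _ _ _ y
  have ty' := @tgt_eq_zero _ _ _ y'
  have sx := @src_eq_zero _ _ _ x
  have sx' := @src_eq_zero _ _ _ x'
  have sy := @src_eq_zero _ _ _ y
  have sy' := @src_eq_zero _ _ _ y'
  -- Sixteen orientations of the four edges; `omega` discards those incompatible with the layers.
  rcases h1 with ⟨a1, b1, c1⟩ | ⟨a1, b1, c1⟩ <;> rcases h2 with ⟨a2, b2, c2⟩ | ⟨a2, b2, c2⟩ <;>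
    rcases h3 with ⟨a3, b3, c3⟩ | ⟨a3, b3, c3⟩ <;> rcases h4 with ⟨a4, b4, c4⟩ | ⟨a4, b4, c4⟩ <;>
    first
    | (exfalso; omega)
    | grind

lemma exists_webGraph_adj (hr : 1 ≤ r) : ∃ u v, (webGraph r q).Adj u v :=
  ⟨ofPath 0 0 0, ofPath 1 0 0, Or.inl ⟨by simp; omega, by simp, by simp⟩⟩

lemma next_ofPath {j : ℕ} (hj : j < r) (a b : Fin r → Fin q) :
    Next (ofPath j a b) (ofPath (j + 1) a b) := by
  refine ⟨?_, ?_, ?_⟩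
  · rw [layer_ofPath, layer_ofPath]
    omega
  · intro h
    rw [layer_ofPath] at h
    rw [tgt_ofPath, tgt_ofPath, if_neg (by omega), if_neg (by omega)]
  · intro h
    rw [layer_ofPath] at h
    rw [src_ofPath, src_ofPath, if_neg (by omega), if_neg (by omega)]

/-- From a source the fan runs forward to all targets, from a target backward to all sources. -/
lemma isFanSystem_webGraph (hr : 1 ≤ r) :
    IsFanSystem (webGraph r q) r {x | x.layer = 0 ∨ x.layer = r}
      fun v (c : Fin r → Fin q) i =>
        if v.layer = 0 then ofPath i v.src c else ofPath (r - i) c v.tgt where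
  zero := by
    intro v hv c
    rw [ext_iff']
    split_ifs with h
    · rw [layer_ofPath, src_ofPath, tgt_ofPath, if_neg (by omega), if_pos rfl, tgt_eq_zero h]
      exact ⟨by omega, rfl, rfl⟩
    · have hv' : v.layer = r := hv.resolve_left h
      rw [layer_ofPath, src_ofPath, tgt_ofPath, if_pos (by omega), if_neg (by omega),
        src_eq_zero hv']
      exact ⟨by omega, rfl, rfl⟩
  adj := by
    intro v hv c i hi
    split_ifs with h
    · exact Or.inl (next_ofPath hi _ _)
    · have := next_ofPath (show r - (i + 1) < r by omega) c v.tgt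
      rw [show r - (i + 1) + 1 = r - i by omega] at this
      exact Or.inr this
  mem := by
    intro v hv c
    split_ifs with h
    · right; simp
    · left; simp
  inj := by
    intro v hv c c' i i' h1 h2 h3 h4 he
    split_ifs at he with h
    · rw [ext_iff'] at he
      simp only [layer_ofPath, tgt_ofPath, if_neg (show i ≠ 0 by omega),
        if_neg (show i' ≠ 0 by omega)] at he
      exact ⟨he.2.2, by omega⟩
    · rw [ext_iff'] at he
      simp only [layer_ofPath, src_ofPath, if_neg (show ¬ r ≤ r - i by omega),
        if_neg (show ¬ r ≤ r - i' by omega)] at he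
      exact ⟨he.2.1, by omega⟩
  ne := by
    intro v hv c i h1 h2 he
    have hl := congrArg layer he
    split_ifs at hl with h
    · rw [layer_ofPath] at hl
      omega
    · have hv' : v.layer = r := hv.resolve_left h
      rw [layer_ofPath] at hl
      omega

end WebGraph


open WebVertex

/-! ### Folding the paths into a butterfly network -/

section WebGraph

variable {r q : ℕ} [NeZero q]

/-- The labels by which the vertices of the web graph are grouped: a flag that tells the vertices
on already united paths, the layer, and the known letters of source and target. -/
abbrev WebLabel (r q : ℕ) : Type := Bool × ℕ × (Fin r → Fin q) × (Fin r → Fin q)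

/-- The vertex is an end of a path, or lies on a path with source in `K`. -/
def IsUnited (K : Finset (Fin r → Fin q)) (x : WebVertex r q) : Prop :=
  x.src ∈ K ∨ x.layer = 0 ∨ x.layer = r

open Classical in
/-- The paths with source in `K` are united in a butterfly network. On those with source `k`, all
but the first `max j i` letters of the target have been forgotten in layer `j`. -/
noncomputable def uniteLabel (K : Finset (Fin r → Fin q)) (k : Fin r → Fin q) (i : ℕ)
    (x : WebVertex r q) : WebLabel r q :=
  if IsUnited K x then (true, x.layer, wordTail x.layer x.src, wordHead x.layer x.tgt)
  else (false, x.layer, x.src,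
    if x.src = k then wordHead (max x.layer i) x.tgt else x.tgt)

variable {K K' : Finset (Fin r → Fin q)} {k : Fin r → Fin q} {i i' : ℕ} {x y : WebVertex r q}

lemma uniteLabel_of_isUnited (h : IsUnited K x) : uniteLabel K k i x =
    (true, x.layer, wordTail x.layer x.src, wordHead x.layer x.tgt) := if_pos h

lemma uniteLabel_of_not (h : ¬ IsUnited K x) : uniteLabel K k i x = (false, x.layer, x.src,
    if x.src = k then wordHead (max x.layer i) x.tgt else x.tgt) := if_neg h

lemma IsUnited.mono (hK : K ⊆ K') (h : IsUnited K x) : IsUnited K' x :=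
  h.imp_left fun h => hK h

lemma isUnited_of_uniteLabel_eq (hx : IsUnited K x) (h : uniteLabel K k i y = uniteLabel K k i x) :
    IsUnited K y ∧ y.layer = x.layer ∧ wordTail x.layer y.src = wordTail x.layer x.src ∧
      wordHead x.layer y.tgt = wordHead x.layer x.tgt := by
  by_cases hy : IsUnited K y
  · rw [uniteLabel_of_isUnited hx, uniteLabel_of_isUnited hy] at h
    simp only [Prod.mk.injEq, true_and] at h
    obtain ⟨h1, h2, h3⟩ := h
    rw [h1] at h2 h3
    exact ⟨hy, h1, h2, h3⟩
  · rw [uniteLabel_of_isUnited hx, uniteLabel_of_not hy] at h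
    simp at h

lemma not_isUnited_of_uniteLabel_eq (hx : ¬ IsUnited K x)
    (h : uniteLabel K k i y = uniteLabel K k i x) :
    ¬ IsUnited K y ∧ y.layer = x.layer ∧ y.src = x.src ∧ (x.src ≠ k → y.tgt = x.tgt) ∧
      wordHead (max x.layer i) y.tgt = wordHead (max x.layer i) x.tgt := by
  by_cases hy : IsUnited K y
  · rw [uniteLabel_of_not hx, uniteLabel_of_isUnited hy] at h
    simp at h
  · rw [uniteLabel_of_not hx, uniteLabel_of_not hy] at h
    simp only [Prod.mk.injEq, true_and] at h
    obtain ⟨h1, h2, h3⟩ := h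
    rw [h1, h2] at h3
    refine ⟨hy, h1, h2, fun hk => by simpa [hk] using h3, ?_⟩
    by_cases hk : x.src = k
    · simpa [hk] using h3
    · rw [if_neg hk, if_neg hk] at h3
      rw [h3]

lemma uniteLabel_coarsen (hK : K ⊆ K') (hi : i' ≤ i)
    (h : uniteLabel K k i x = uniteLabel K k i y) :
    uniteLabel K' k i' x = uniteLabel K' k i' y := by
  by_cases hy : IsUnited K y
  · obtain ⟨hx, h1, h2, h3⟩ := isUnited_of_uniteLabel_eq hy h
    rw [uniteLabel_of_isUnited (hx.mono hK), uniteLabel_of_isUnited (hy.mono hK), h1, h2, h3]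
  · obtain ⟨hx, h1, h2, h3, h4⟩ := not_isUnited_of_uniteLabel_eq hy h
    have hxy : IsUnited K' x ↔ IsUnited K' y := by rw [IsUnited, IsUnited, h1, h2]
    by_cases hy' : IsUnited K' y
    · rw [uniteLabel_of_isUnited hy', uniteLabel_of_isUnited (hxy.2 hy'), h1, h2,
        wordHead_eq_of_le (le_max_left _ i) h4]
    · rw [uniteLabel_of_not hy', uniteLabel_of_not (mt hxy.1 hy'), h1, h2]
      by_cases hk : y.src = k
      · rw [if_pos hk, if_pos hk, wordHead_eq_of_le (max_le_max_left _ hi) h4]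
      · rw [h3 hk]

/-- The labels that a united class may see. -/
noncomputable def unitedNeighbours (k : Fin r → Fin q) (i j : ℕ) (α β : Fin r → Fin q) :
    Finset (WebLabel r q) :=
  (Finset.univ.image fun c => (true, j + 1, wordTail (j + 1) α, wordPut j β c)) ∪
  (Finset.univ.image fun c => (false, j + 1, k, wordPut j β c)) ∪
  (Finset.univ.image fun c => (true, j - 1, wordPut (j - 1) α c, wordHead (j - 1) β)) ∪
  {(false, j - 1, k, wordHead (max (j - 1) i) β)}

lemma card_unitedNeighbours_le (k : Fin r → Fin q) (i j : ℕ) (α β : Fin r → Fin q) :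
    (unitedNeighbours k i j α β).card ≤ 3 * q + 1 := by
  refine (Finset.card_union_le _ _).trans (Nat.add_le_add ?_ (by simp))
  refine (Finset.card_union_le _ _).trans ?_
  refine (Nat.add_le_add (Finset.card_union_le _ _) le_rfl).trans ?_
  have h : ∀ f : Fin q → WebLabel r q, (Finset.univ.image f).card ≤ q := fun f =>
    Finset.card_image_le.trans (by simp)
  refine (Nat.add_le_add (Nat.add_le_add (h _) (h _)) (h _)).trans ?_
  omega

lemma wordPut_wordHead_of_eq {j : ℕ} (hj : j < r) {β b : Fin r → Fin q}
    (h : wordHead j b = β) : wordPut j β (b ⟨j, hj⟩) = wordHead (j + 1) b := by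
  subst h
  ext m
  simp only [wordPut, wordHead]
  by_cases h1 : m.val = j
  · subst h1; simp
  · rw [if_neg h1]
    by_cases h2 : m.val < j
    · rw [if_pos h2, if_pos (by omega)]
    · rw [if_neg h2, if_neg (by omega)]

lemma wordPut_wordTail_of_eq {j : ℕ} (hj : j < r) {α a : Fin r → Fin q}
    (h : wordTail (j + 1) a = α) : wordPut j α (a ⟨j, hj⟩) = wordTail j a := by
  subst h
  ext m
  simp only [wordPut, wordTail]
  by_cases h1 : m.val = j
  · subst h1; simp
  · rw [if_neg h1]
    by_cases h2 : j + 1 ≤ m.val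
    · rw [if_pos h2, if_pos (by omega)]
    · rw [if_neg h2, if_neg (by omega)]

/-- A united class sees q united and q torn classes in the next layer, and q united classes and one
torn class in the previous one. Paths from sources other than `k` and outside `K'` meet it only at
their ends, where the edges are black. -/
lemma uniteLabel_mem_of_isUnited (hKK : K' ⊆ insert k K) (hk : k ∈ K' → i = 0) (hir : i ≤ r)
    (hx : IsUnited K' x) {x' : WebVertex r q} (hx' : uniteLabel K' k i' x' = uniteLabel K' k i' x)
    (hadj : (webGraph r q).Adj x' y)
    (hnot : ¬ ∀ u v, uniteLabel K' k i' u = uniteLabel K' k i' x →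
      uniteLabel K' k i' v = uniteLabel K' k i' y → (webGraph r q).Adj u v) :
    uniteLabel K k i y ∈ unitedNeighbours k i x.layer (wordTail x.layer x.src)
      (wordHead x.layer x.tgt) := by
  obtain ⟨hu, hj, hα, hβ⟩ := isUnited_of_uniteLabel_eq hx hx'
  rw [← hα, ← hβ]
  have hxr := x'.layer_le
  have hyr := y.layer_le
  simp only [unitedNeighbours, Finset.mem_union, Finset.mem_image, Finset.mem_univ, true_and,
    Finset.mem_singleton]
  rw [← hj]
  rcases hadj with h | h
  · have hlt : x'.layer < r := by have := h.1; omega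
    have hhead := wordPut_wordHead_of_eq hlt h.wordHead_eq.symm
    by_cases hy : IsUnited K y
    · left; left; left
      refine ⟨y.tgt ⟨_, hlt⟩, ?_⟩
      rw [uniteLabel_of_isUnited hy, hhead, wordTail_wordTail, max_eq_left (by omega), ← h.1,
        h.wordTail_eq]
    · have hsrc : x'.src = y.src := h.2.2 fun h' => hy (Or.inr (Or.inr h'))
      by_cases hxK : x'.src ∈ K'
      · have hyk : y.src = k := by
          rw [hsrc] at hxK
          exact (Finset.mem_insert.1 (hKK hxK)).resolve_right fun h' => hy (Or.inl h')
        -- With i = 0, torn classes in the next layer keep just one target letter more than is known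
        -- here, hence q candidates.
        have hi0 : i = 0 := hk (by rwa [hsrc, hyk] at hxK)
        left; left; right
        refine ⟨y.tgt ⟨_, hlt⟩, ?_⟩
        rw [uniteLabel_of_not hy, if_pos hyk, hi0, hyk, hhead, h.1, max_eq_left (by omega)]
      -- Here `x'` is a source outside `K'` and `y` begins one of its paths: the two classes are
      -- completely joined.
      · exfalso
        have hx0 : x'.layer = 0 := by
          rcases hu with hu | hu | hu
          · exact absurd hu hxK
          · exact hu
          · omega
        have hy' : ¬ IsUnited K' y := by
          rintro (h1 | h1 | h1)
          · exact hxK (hsrc ▸ h1)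
          · exact hy (Or.inr (Or.inl h1))
          · exact hy (Or.inr (Or.inr h1))
        refine hnot fun u v hu' hv => Or.inl ?_
        obtain ⟨-, h1, h2, -⟩ := isUnited_of_uniteLabel_eq hx hu'
        obtain ⟨-, h4, h5, -⟩ := not_isUnited_of_uniteLabel_eq hy' hv
        rw [← hα, ← hj, hx0, wordTail_zero, wordTail_zero] at h2
        refine ⟨by rw [h4, h1, h.1, hj], fun h' => absurd (h1.trans (hj.symm.trans hx0)) h', ?_⟩
        intro _
        rw [h2, h5, hsrc]
  · have hlt : y.layer < r := by have := h.1; omega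
    have hj1 : x'.layer - 1 = y.layer := by have := h.1; omega
    have htail := wordPut_wordTail_of_eq hlt (h.1 ▸ h.wordTail_eq)
    by_cases hy : IsUnited K y
    · left; right
      refine ⟨y.src ⟨_, hlt⟩, ?_⟩
      rw [uniteLabel_of_isUnited hy, hj1, h.1, htail, wordHead_wordHead,
        min_eq_left (by omega), h.wordHead_eq]
    · have hy0 : y.layer ≠ 0 := fun h' => hy (Or.inr (Or.inl h'))
      have htgt : y.tgt = x'.tgt := h.2.1 hy0
      right
      by_cases hxr' : x'.layer = r
      · by_cases hyk : y.src = k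
        · rw [uniteLabel_of_not hy, if_pos hyk, hyk, hj1, wordHead_wordHead,
            min_eq_left (by omega), htgt]
        -- Here `x'` is a target and `y` the last inner vertex of an untouched path: again the
        -- classes are completely joined.
        · exfalso
          have hy' : ¬ IsUnited K' y := by
            rintro (h1 | h1 | h1)
            · rcases Finset.mem_insert.1 (hKK h1) with h2 | h2
              · exact hyk h2
              · exact hy (Or.inl h2)
            · exact hy0 h1
            · omega
          refine hnot fun u v hu' hv => Or.inr ?_
          obtain ⟨-, h1, -, h3⟩ := isUnited_of_uniteLabel_eq hx hu'
          obtain ⟨-, h4, -, h5, -⟩ := not_isUnited_of_uniteLabel_eq hy' hv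
          rw [← hβ, ← hj, hxr', wordHead_of_le le_rfl, wordHead_of_le le_rfl] at h3
          refine ⟨by rw [h4, h1, ← hj, h.1], fun _ => by rw [h5 hyk, h3, htgt], fun h' => ?_⟩
          omega
      · have hsrc : y.src = x'.src := h.2.2 hxr'
        have hxK : x'.src ∈ K' := by
          rcases hu with hu | hu | hu
          · exact hu
          · have := h.1; omega
          · exact absurd hu hxr'
        have hyk : y.src = k := by
          rw [← hsrc] at hxK
          exact (Finset.mem_insert.1 (hKK hxK)).resolve_right fun h' => hy (Or.inl h')
        have hi0 : i = 0 := hk (by rwa [← hsrc, hyk] at hxK)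
        rw [uniteLabel_of_not hy, if_pos hyk, hyk, hj1, hi0, wordHead_wordHead,
          min_eq_left (by omega), htgt]

/-- The labels that a class on the paths with source `k` may see. -/
noncomputable def tornNeighbours (k : Fin r → Fin q) (i n j : ℕ) (β : Fin r → Fin q) :
    Finset (WebLabel r q) :=
  (Finset.univ.image fun c => (false, j + 1, k, wordHead (max (j + 1) i) (wordPut n β c))) ∪
  (Finset.univ.image fun c => (true, j + 1, 0, wordHead (j + 1) (wordPut n β c))) ∪
  (Finset.univ.image fun c => (false, j - 1, k, wordHead (max (j - 1) i) (wordPut n β c))) ∪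
  {(true, 0, k, 0)}

lemma card_tornNeighbours_le (k : Fin r → Fin q) (i n j : ℕ) (β : Fin r → Fin q) :
    (tornNeighbours k i n j β).card ≤ 3 * q + 1 := by
  refine (Finset.card_union_le _ _).trans (Nat.add_le_add ?_ (by simp))
  refine (Finset.card_union_le _ _).trans ?_
  refine (Nat.add_le_add (Finset.card_union_le _ _) le_rfl).trans ?_
  have h : ∀ f : Fin q → WebLabel r q, (Finset.univ.image f).card ≤ q := fun f =>
    Finset.card_image_le.trans (by simp)
  refine (Nat.add_le_add (Nat.add_le_add (h _) (h _)) (h _)).trans ?_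
  omega

/-- The class knows the first `max x.layer i'` target letters, and neighbours know at most one more
since i ≤ i' + 1. This gives q candidates for each of three kinds of neighbour; the fourth is the
source `k` itself. -/
lemma uniteLabel_mem_of_src_eq (hK : K ⊆ K') (hi : i ≤ i' + 1)
    (hx : ¬ IsUnited K' x) (hxk : x.src = k) {x' : WebVertex r q}
    (hx' : uniteLabel K' k i' x' = uniteLabel K' k i' x) (hadj : (webGraph r q).Adj x' y) :
    uniteLabel K k i y ∈ tornNeighbours k i (max x.layer i') x.layer
      (wordHead (max x.layer i') x.tgt) := by
  obtain ⟨hu, hj, hs, -, hβ⟩ := not_isUnited_of_uniteLabel_eq hx hx'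
  rw [← hβ]
  simp only [tornNeighbours, Finset.mem_union, Finset.mem_image, Finset.mem_univ, true_and,
    Finset.mem_singleton]
  have hkK : k ∉ K := fun h => hx (Or.inl (hxk ▸ hK h))
  have hx0 : x'.layer ≠ 0 := fun h => hu (Or.inr (Or.inl h))
  have hxr : x'.layer ≠ r := fun h => hu (Or.inr (Or.inr h))
  rw [← hj]
  rcases hadj with h | h
  · have htgt : x'.tgt = y.tgt := h.2.1 hx0
    have h1 := h.1
    by_cases hy : y.layer = r
    · obtain ⟨c, hc⟩ := exists_wordHead_eq (show x'.layer + 1 ≤ max x'.layer i' + 1 by omega) y.tgt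
      left; left; right
      refine ⟨c, ?_⟩
      rw [uniteLabel_of_isUnited (Or.inr (Or.inr hy)), src_eq_zero hy, h.1, htgt, ← hc,
        wordTail_of_le (by omega)]
    · have hyk : y.src = k := by rw [← h.2.2 hy, hs, hxk]
      have hyu : ¬ IsUnited K y := by
        rintro (h2 | h2 | h2)
        · exact hkK (hyk ▸ h2)
        · omega
        · exact hy h2
      obtain ⟨c, hc⟩ := exists_wordHead_eq
        (show max (x'.layer + 1) i ≤ max x'.layer i' + 1 by omega) y.tgt
      left; left; left
      refine ⟨c, ?_⟩
      rw [uniteLabel_of_not hyu, if_pos hyk, hyk, h.1, htgt, ← hc]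
  · have hyk : y.src = k := by rw [h.2.2 hxr, hs, hxk]
    have h1 := h.1
    have hyr := x'.layer_le
    by_cases hy : y.layer = 0
    · right
      rw [uniteLabel_of_isUnited (Or.inr (Or.inl hy)), hy, wordTail_zero, wordHead_zero, hyk]
    · have htgt : y.tgt = x'.tgt := h.2.1 hy
      have hyu : ¬ IsUnited K y := by
        rintro (h2 | h2 | h2)
        · exact hkK (hyk ▸ h2)
        · exact hy h2
        · omega
      obtain ⟨c, hc⟩ := exists_wordHead_eq
        (show max (x'.layer - 1) i ≤ max x'.layer i' + 1 by omega) y.tgt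
      left; right
      refine ⟨c, ?_⟩
      rw [uniteLabel_of_not hyu, if_pos hyk, hyk, ← htgt, ← hc, h.1, Nat.add_sub_cancel]

/-- Such a class is a single inner vertex, of degree two; the four labels allow each neighbour to be
an end or not. -/
lemma uniteLabel_mem_of_src_ne (hK : K ⊆ K') (hx : ¬ IsUnited K' x) (hxk : x.src ≠ k)
    {x' : WebVertex r q} (hx' : uniteLabel K' k i' x' = uniteLabel K' k i' x)
    (hadj : (webGraph r q).Adj x' y) :
    uniteLabel K k i y ∈ ({(false, x.layer + 1, x.src, x.tgt), (true, x.layer + 1, 0, x.tgt),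
      (false, x.layer - 1, x.src, x.tgt), (true, x.layer - 1, x.src, 0)} :
        Finset (WebLabel r q)) := by
  obtain ⟨hu, hj, hs, ht, -⟩ := not_isUnited_of_uniteLabel_eq hx hx'
  obtain rfl : x' = x := ext_iff'.2 ⟨hj, hs, ht hxk⟩
  simp only [Finset.mem_insert, Finset.mem_singleton]
  have hkK : x'.src ∉ K := fun h => hx (Or.inl (hK h))
  have hx0 : x'.layer ≠ 0 := fun h => hu (Or.inr (Or.inl h))
  have hxr : x'.layer ≠ r := fun h => hu (Or.inr (Or.inr h))
  rcases hadj with h | h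
  · have htgt : x'.tgt = y.tgt := h.2.1 hx0
    by_cases hy : y.layer = r
    · right; left
      rw [uniteLabel_of_isUnited (Or.inr (Or.inr hy)), src_eq_zero hy, htgt,
        wordTail_of_le hy.ge, wordHead_of_le hy.ge, h.1]
    · have hsrc := h.2.2 hy
      have hyu : ¬ IsUnited K y := by
        rintro (h2 | h2 | h2)
        · exact hkK (hsrc ▸ h2)
        · have := h.1; omega
        · exact hy h2
      left
      rw [uniteLabel_of_not hyu, if_neg (hsrc ▸ hxk), h.1, hsrc, htgt]
  · have hsrc := h.2.2 hxr
    have h1 : x'.layer - 1 = y.layer := by have := h.1; omega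
    rw [h1]
    by_cases hy : y.layer = 0
    · right; right; right
      rw [uniteLabel_of_isUnited (Or.inr (Or.inl hy)), hy, wordTail_zero, wordHead_zero, hsrc]
    · have htgt := h.2.1 hy
      have hyu : ¬ IsUnited K y := by
        rintro (h2 | h2 | h2)
        · exact hkK (hsrc ▸ h2)
        · exact hy h2
        · have := h.1; have := x'.layer_le; omega
      right; right; left
      rw [uniteLabel_of_not hyu, if_neg (hsrc ▸ hxk), hsrc, htgt]

variable {V : Type*} [Fintype V] [DecidableEq V]

/-- Serves two moves: forgetting one more target letter on the paths from `k` (K' = K), and uniting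
those paths with the network (K' = K ∪ {k}, i = 0). -/
lemma uniteLabel_step {d : ℕ} (hd : 3 * q + 1 ≤ d) (p : V → WebVertex r q) (hK : K ⊆ K')
    (hKK : K' ⊆ insert k K) (hk : k ∈ K' → i = 0) (hir : i ≤ r) (hi' : i' ≤ i) (hi : i ≤ i' + 1) :
    Relation.ReflTransGen (QuotientStep ((webGraph r q).comap p) d)
      (Setoid.ker (uniteLabel K k i ∘ p)) (Setoid.ker (uniteLabel K' k i' ∘ p)) := by
  refine reflTransGen_ker_comap _ p d _ _ (fun x y h => uniteLabel_coarsen hK hi' h) fun x => ?_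
  by_cases hx : IsUnited K' x
  · exact ⟨_, (card_unitedNeighbours_le _ _ _ _ _).trans hd, fun x' y hx' hadj hnot =>
      uniteLabel_mem_of_isUnited hKK hk hir hx hx' hadj hnot⟩
  · by_cases hxk : x.src = k
    · exact ⟨_, (card_tornNeighbours_le _ _ _ _ _).trans hd, fun x' y hx' hadj _ =>
        uniteLabel_mem_of_src_eq hK hi hx hxk hx' hadj⟩
    · refine ⟨_, Finset.card_le_four.trans ?_, fun x' y hx' hadj _ =>
        uniteLabel_mem_of_src_ne hK hx hxk hx' hadj⟩
      have := NeZero.pos q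
      omega

/-- At i = r no target letter is forgotten, so the next source may be chosen freely. -/
lemma uniteLabel_eq_of_le (k k' : Fin r → Fin q) : uniteLabel K k r = uniteLabel K k' r := by
  ext1 x
  by_cases hx : IsUnited K x
  · rw [uniteLabel_of_isUnited hx, uniteLabel_of_isUnited hx]
  · rw [uniteLabel_of_not hx, uniteLabel_of_not hx, wordHead_of_le (le_max_right _ _), ite_self,
      ite_self]

lemma uniteLabel_eq_of_mem (hk : k ∈ K) : uniteLabel K k i = uniteLabel K k i' := by
  ext1 x
  by_cases hx : IsUnited K x
  · rw [uniteLabel_of_isUnited hx, uniteLabel_of_isUnited hx]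
  · have hxk : x.src ≠ k := fun h => hx (Or.inl (h ▸ hk))
    rw [uniteLabel_of_not hx, uniteLabel_of_not hx, if_neg hxk, if_neg hxk]

lemma uniteLabel_forget {d : ℕ} (hd : 3 * q + 1 ≤ d) (p : V → WebVertex r q) (hk : k ∉ K)
    (hi : i ≤ r) :
    Relation.ReflTransGen (QuotientStep ((webGraph r q).comap p) d)
      (Setoid.ker (uniteLabel K k i ∘ p)) (Setoid.ker (uniteLabel K k 0 ∘ p)) := by
  induction i with
  | zero => exact Relation.ReflTransGen.refl
  | succ i ih =>
    exact (uniteLabel_step hd p subset_rfl (Finset.subset_insert _ _) (fun h => absurd h hk) hi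
      (by omega) le_rfl).trans (ih (by omega))

lemma uniteLabel_chain {d : ℕ} (hd : 3 * q + 1 ≤ d) (p : V → WebVertex r q)
    (K : Finset (Fin r → Fin q)) :
    Relation.ReflTransGen (QuotientStep ((webGraph r q).comap p) d)
      (Setoid.ker (uniteLabel ∅ 0 r ∘ p)) (Setoid.ker (uniteLabel K 0 r ∘ p)) := by
  classical
  induction K using Finset.induction_on with
  | empty => exact Relation.ReflTransGen.refl
  | insert k K hk ih =>
    refine ih.trans ?_
    -- The stage begins with `k` intact (i = r) and ends with `k` united, where the value of i no
    -- longer matters.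
    rw [uniteLabel_eq_of_le 0 k, uniteLabel_eq_of_le 0 k,
      uniteLabel_eq_of_mem (i := r) (i' := 0) (Finset.mem_insert_self k K)]
    refine (uniteLabel_forget hd p hk le_rfl).trans ?_
    have h1 : K ⊆ insert k K := Finset.subset_insert _ _
    have h2 : insert k K ⊆ insert k K := subset_rfl
    exact uniteLabel_step hd p h1 (by convert h2) (fun _ => rfl) (Nat.zero_le _) le_rfl (by omega)

lemma uniteLabel_empty_injective :
    Function.Injective (uniteLabel (∅ : Finset (Fin r → Fin q)) 0 r) := by
  intro x y h
  rw [ext_iff']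
  by_cases hy : IsUnited ∅ y
  · obtain ⟨hx, h1, h2, h3⟩ := isUnited_of_uniteLabel_eq hy h
    have hy' : y.layer = 0 ∨ y.layer = r := hy.resolve_left (by simp)
    refine ⟨h1, ?_⟩
    rcases hy' with h0 | h0
    · rw [h0, wordTail_zero, wordTail_zero] at h2
      exact ⟨h2, by rw [tgt_eq_zero h0, tgt_eq_zero (h1.trans h0)]⟩
    · rw [h0, wordHead_of_le le_rfl, wordHead_of_le le_rfl] at h3
      exact ⟨by rw [src_eq_zero h0, src_eq_zero (h1.trans h0)], h3⟩
  · obtain ⟨-, h1, h2, -, h3⟩ := not_isUnited_of_uniteLabel_eq hy h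
    rw [wordHead_of_le (le_max_right _ _), wordHead_of_le (le_max_right _ _)] at h3
    exact ⟨h1, h2, h3⟩

/-! ### Collapsing the butterfly: source letters -/

/-- In layer `j` of the butterfly network, the first `max j ((t + j + 1) / 2)` letters of the
source are forgotten. -/
def sourceLabel (t : ℕ) (x : WebVertex r q) : ℕ × (Fin r → Fin q) × (Fin r → Fin q) :=
  (x.layer, wordTail (max x.layer ((t + x.layer + 1) / 2)) x.src, wordHead x.layer x.tgt)

lemma sourceLabel_eq_iff {t : ℕ} : sourceLabel t x = sourceLabel t y ↔ x.layer = y.layer ∧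
    wordTail (max y.layer ((t + y.layer + 1) / 2)) x.src =
      wordTail (max y.layer ((t + y.layer + 1) / 2)) y.src ∧
    wordHead y.layer x.tgt = wordHead y.layer y.tgt := by
  rw [sourceLabel, sourceLabel, Prod.mk.injEq, Prod.mk.injEq]
  refine and_congr_right fun h => ?_
  rw [h]

lemma ker_uniteLabel_univ : Setoid.ker (uniteLabel (Finset.univ : Finset (Fin r → Fin q)) 0 r) =
    Setoid.ker (sourceLabel 0) := by
  ext x y
  rw [Setoid.ker_def, Setoid.ker_def, sourceLabel_eq_iff,
    uniteLabel_of_isUnited (Or.inl (Finset.mem_univ _)),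
    uniteLabel_of_isUnited (Or.inl (Finset.mem_univ _)),
    max_eq_left (show (0 + y.layer + 1) / 2 ≤ y.layer by omega)]
  simp only [Prod.mk.injEq, true_and]
  refine and_congr_right fun h => ?_
  rw [h]

/-- Halving staggers the forgetting, so that letters vanish in layers of one parity at a time. After
a step, layer j knows all the source letters that layer j + 1 knew before it, and at most one fewer
than layer j - 1 did. So there are q candidates ahead (a target letter) and q behind (a source
letter). -/
lemma sourceLabel_step {d : ℕ} (hd : 2 * q ≤ d) (p : V → WebVertex r q) (t : ℕ) :
    Relation.ReflTransGen (QuotientStep ((webGraph r q).comap p) d)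
      (Setoid.ker (sourceLabel t ∘ p)) (Setoid.ker (sourceLabel (t + 1) ∘ p)) := by
  refine reflTransGen_ker_comap _ p d _ _ ?_ ?_
  · intro x y h
    rw [sourceLabel_eq_iff] at h ⊢
    exact ⟨h.1, wordTail_eq_of_le (by omega) h.2.1, h.2.2⟩
  · intro x
    set n := max x.layer ((t + 1 + x.layer + 1) / 2) with hn
    set j := x.layer with hj
    refine ⟨(Finset.univ.image fun c => (j + 1,
        wordTail (max (j + 1) ((t + (j + 1) + 1) / 2)) (wordTail n x.src),
        wordHead (j + 1) (wordPut j (wordHead j x.tgt) c))) ∪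
      (Finset.univ.image fun c => (j - 1,
        wordTail (max (j - 1) ((t + (j - 1) + 1) / 2)) (wordPut (n - 1) (wordTail n x.src) c),
        wordHead (j - 1) (wordHead j x.tgt))), ?_, ?_⟩
    · refine (Finset.card_union_le _ _).trans ((Nat.add_le_add Finset.card_image_le
        Finset.card_image_le).trans ?_)
      simp
      omega
    · rintro x' y hx hadj -
      rw [sourceLabel_eq_iff] at hx
      obtain ⟨h1, h2, h3⟩ := hx
      rw [← hj] at h1 h2 h3
      rw [← hn] at h2
      rw [← h2, ← h3, Finset.mem_union, Finset.mem_image, Finset.mem_image]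
      rcases hadj with h | h
      · left
        obtain ⟨c, hc⟩ := exists_wordHead_eq (le_refl (j + 1)) y.tgt
        have hy := h.1
        have hh := h.wordHead_eq
        rw [h1] at hh hy
        refine ⟨c, Finset.mem_univ _, ?_⟩
        rw [sourceLabel, hy, hh, ← hc, wordTail_wordTail, max_eq_left (by omega),
          wordTail_eq_of_le (by rw [hy]; omega) h.wordTail_eq]
      · right
        have hy : y.layer = j - 1 := by have := h.1; omega
        obtain ⟨c, hc⟩ := exists_wordTail_eq
          (show n ≤ max (j - 1) ((t + (j - 1) + 1) / 2) + 1 by have := h.1; omega) y.src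
        have ht := wordTail_eq_of_le (show x'.layer ≤ n by omega) h.wordTail_eq
        refine ⟨c, Finset.mem_univ _, ?_⟩
        rw [sourceLabel, hy, ← ht, ← hc, wordHead_wordHead, min_eq_left (by omega), ← hy,
          h.wordHead_eq]

lemma sourceLabel_chain {d : ℕ} (hd : 2 * q ≤ d) (p : V → WebVertex r q) (t : ℕ) :
    Relation.ReflTransGen (QuotientStep ((webGraph r q).comap p) d)
      (Setoid.ker (sourceLabel 0 ∘ p)) (Setoid.ker (sourceLabel t ∘ p)) := by
  induction t with
  | zero => exact Relation.ReflTransGen.refl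
  | succ t ih => exact ih.trans (sourceLabel_step hd p t)

/-! ### Collapsing the remaining tree of target prefixes -/

/-- The first `min j J` letters of the target in layer `j`, where the layers from `J` on are
identified. -/
def targetLabel (J : ℕ) (x : WebVertex r q) : ℕ × (Fin r → Fin q) :=
  (min x.layer J, wordHead (min x.layer J) x.tgt)

lemma targetLabel_eq_iff {J : ℕ} : targetLabel J x = targetLabel J y ↔
    min x.layer J = min y.layer J ∧
    wordHead (min y.layer J) x.tgt = wordHead (min y.layer J) y.tgt := by
  rw [targetLabel, targetLabel, Prod.mk.injEq]
  refine and_congr_right fun h => ?_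
  rw [h]

lemma ker_sourceLabel_eq :
    Setoid.ker (sourceLabel (r := r) (q := q) (2 * r)) = Setoid.ker (targetLabel r) := by
  ext x y
  have hx := x.layer_le
  have hy := y.layer_le
  rw [Setoid.ker_def, Setoid.ker_def, sourceLabel_eq_iff, targetLabel_eq_iff, min_eq_left hx,
    min_eq_left hy, wordTail_of_le (by omega), wordTail_of_le (by omega)]
  simp

/-- The deepest level of the tree is folded into its parents; a class sees q children, its parent,
and possibly its own label, since children merge into it. -/
lemma targetLabel_step {d : ℕ} (hd : q + 2 ≤ d) (p : V → WebVertex r q) (J : ℕ) :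
    Relation.ReflTransGen (QuotientStep ((webGraph r q).comap p) d)
      (Setoid.ker (targetLabel (J + 1) ∘ p)) (Setoid.ker (targetLabel J ∘ p)) := by
  refine reflTransGen_ker_comap _ p d _ _ ?_ ?_
  · intro x y h
    rw [targetLabel_eq_iff] at h ⊢
    exact ⟨by omega, wordHead_eq_of_le (by omega) h.2⟩
  · intro x
    set j := min x.layer J with hj
    set β := wordHead j x.tgt with hβ
    refine ⟨(Finset.univ.image fun c => (j + 1, wordHead (j + 1) (wordPut j β c))) ∪
      {(j, β), (j - 1, wordHead (j - 1) β)}, ?_, ?_⟩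
    · refine (Finset.card_union_le _ _).trans ((Nat.add_le_add Finset.card_image_le
        Finset.card_le_two).trans ?_)
      simpa using hd
    · rintro x' y hx hadj -
      rw [targetLabel_eq_iff] at hx
      obtain ⟨h1, h2⟩ := hx
      rw [← hj] at h1 h2
      rw [hβ, ← h2, Finset.mem_union, Finset.mem_image, Finset.mem_insert, Finset.mem_singleton]
      have key : y.layer ≤ x'.layer + 1 ∧ x'.layer ≤ y.layer + 1 ∧
          wordHead (min x'.layer y.layer) x'.tgt = wordHead (min x'.layer y.layer) y.tgt := by
        rcases hadj with h | h
        · have := h.1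
          rw [min_eq_left (by omega)]
          exact ⟨by omega, by omega, h.wordHead_eq⟩
        · have := h.1
          rw [min_eq_right (by omega)]
          exact ⟨by omega, by omega, h.wordHead_eq.symm⟩
      obtain ⟨k1, k2, k3⟩ := key
      have hm : min y.layer (J + 1) = j + 1 ∨ min y.layer (J + 1) = j ∨
          (min y.layer (J + 1) = j - 1 ∧ 1 ≤ j) := by omega
      rcases hm with hm | hm | ⟨hm, hj1⟩
      · left
        obtain ⟨c, hc⟩ := exists_wordHead_eq (le_refl (j + 1)) y.tgt
        refine ⟨c, Finset.mem_univ _, ?_⟩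
        rw [targetLabel, hm, wordHead_eq_of_le (by omega) k3, ← hc]
      · right; left
        rw [targetLabel, hm, wordHead_eq_of_le (by omega) k3]
      · right; right
        rw [targetLabel, hm, wordHead_wordHead, min_eq_left (by omega),
          wordHead_eq_of_le (by omega) k3]

lemma targetLabel_chain {d : ℕ} (hd : q + 2 ≤ d) (p : V → WebVertex r q) (J : ℕ) :
    Relation.ReflTransGen (QuotientStep ((webGraph r q).comap p) d)
      (Setoid.ker (targetLabel J ∘ p)) (Setoid.ker (targetLabel 0 ∘ p)) := by
  induction J with
  | zero => exact Relation.ReflTransGen.refl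
  | succ J ih => exact (targetLabel_step hd p J).trans ih

lemma webGraph_collapse {d : ℕ} (hd : 3 * q + 1 ≤ d) (p : V → WebVertex r q) :
    Relation.ReflTransGen (QuotientStep ((webGraph r q).comap p) d) ⊥ ⊤ := by
  have hq := NeZero.pos q
  have comp : ∀ {C C' : Type} {f : WebVertex r q → C} {f' : WebVertex r q → C'},
      Setoid.ker f = Setoid.ker f' → Setoid.ker (f ∘ p) = Setoid.ker (f' ∘ p) := by
    intro C C' f f' h
    ext x y
    exact iff_of_eq (congrArg (fun S : Setoid (WebVertex r q) => S (p x) (p y)) h)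
  have h1 : Setoid.ker p = Setoid.ker (uniteLabel ∅ 0 r ∘ p) := by
    ext x y
    exact uniteLabel_empty_injective.eq_iff.symm
  have h2 : Setoid.ker (targetLabel 0 ∘ p) = ⊤ := by
    ext x y
    simp [Setoid.ker_def, targetLabel, wordHead_zero]
  have h3 := uniteLabel_chain hd p Finset.univ
  have h4 := sourceLabel_chain (show 2 * q ≤ d by omega) p (2 * r)
  have h5 := targetLabel_chain (show q + 2 ≤ d by omega) p r
  rw [← h1, comp ker_uniteLabel_univ] at h3
  rw [comp ker_sourceLabel_eq] at h4
  rw [h2] at h5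
  exact (reflTransGen_bot_ker_comap _ p d).trans (h3.trans (h4.trans h5))

end WebGraph


/-! ### Assembly and numerical bounds -/

lemma exists_blowUp (q r s d : ℕ) (hq : 1 ≤ q) (hr : 1 ≤ r) (hs : 1 ≤ s) (hd : 3 * q + 1 ≤ d) :
    ∃ (V : Type) (_ : Fintype V) (_ : DecidableEq V) (G : SimpleGraph V),
      G.twinWidth ≤ d ∧ G.bicliqueNumber = s ∧ q ^ r * s ≤ G.scol r := by
  have : NeZero q := ⟨by omega⟩
  -- At r = 1 the web graph is K_{q,q} and has 4-cycles for q ≥ 2, so the cover replaces it.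
  rcases eq_or_lt_of_le hr with rfl | hr2
  · obtain ⟨u, v, huv⟩ := exists_coverGraph_adj hq
    have : Nonempty ((Bool × Fin q × (Fin q × Fin q → Bool)) × Fin s) := ⟨(u, ⟨0, hs⟩)⟩
    refine ⟨_, inferInstance, inferInstance, (coverGraph q).blowUp s,
      Nat.sInf_le (hasContractionSequence_of_reflTransGen _ _
        (coverGraph_collapse (by omega) Prod.fst)),
      bicliqueNumber_blowUp (hasNoFourCycle_coverGraph q) huv s, ?_⟩
    have := (isFanSystem_coverGraph q).le_scol hr hs ⟨u, Set.mem_univ u⟩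
    simpa using this
  · obtain ⟨u, v, huv⟩ := exists_webGraph_adj (r := r) (q := q) hr
    have : Nonempty (WebVertex r q × Fin s) := ⟨(u, ⟨0, hs⟩)⟩
    refine ⟨_, inferInstance, inferInstance, (webGraph r q).blowUp s,
      Nat.sInf_le (hasContractionSequence_of_reflTransGen _ _ (webGraph_collapse hd Prod.fst)),
      bicliqueNumber_blowUp (hasNoFourCycle_webGraph hr2) huv s, ?_⟩
    have := (isFanSystem_webGraph (q := q) hr).le_scol hr hs
      ⟨WebVertex.ofPath 0 0 0, Or.inl (by simp)⟩
    simpa using this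

end SimpleGraph

lemma coloring_bound_le (d s q r : ℕ) (hd : 14 ≤ d) (hr : 1 ≤ r) (hq : d ≤ 4 * q) :
    ((d : ℝ) * (s : ℝ) / 4) * (((d : ℝ) - 4) / 8) ^ (r - 1) ≤ (q : ℝ) ^ r * s := by
  have hd' : (14 : ℝ) ≤ d := by exact_mod_cast hd
  have hq' : (d : ℝ) ≤ 4 * q := by exact_mod_cast hq
  have hpow : (((d : ℝ) - 4) / 8) ^ (r - 1) ≤ (q : ℝ) ^ (r - 1) :=
    pow_le_pow_left₀ (by linarith) (by linarith) _
  calc ((d : ℝ) * (s : ℝ) / 4) * (((d : ℝ) - 4) / 8) ^ (r - 1)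
      ≤ ((q : ℝ) * s) * (q : ℝ) ^ (r - 1) := by
        refine mul_le_mul ?_ hpow (pow_nonneg (by linarith) _) (by positivity)
        have := mul_le_mul_of_nonneg_right hq' (Nat.cast_nonneg (α := ℝ) s)
        linarith
    _ = (q : ℝ) ^ r * s := by
        obtain ⟨m, rfl⟩ := Nat.exists_eq_add_of_le' hr
        rw [Nat.add_sub_cancel, pow_succ]
        ring

lemma twinWidth_bound_le (d s r w : ℕ) (hd : 14 ≤ d) (hr : 1 ≤ r) (hw : w ≤ d) :
    2 * (((w : ℝ) - 4) / 8) ^ r * (s : ℝ) ≤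
      ((d : ℝ) * (s : ℝ) / 4) * (((d : ℝ) - 4) / 8) ^ (r - 1) := by
  have hd' : (14 : ℝ) ≤ d := by exact_mod_cast hd
  have hw' : (w : ℝ) ≤ d := by exact_mod_cast hw
  have hw0 : (0 : ℝ) ≤ w := Nat.cast_nonneg w
  -- For twin-width below 4 the base is negative; its absolute value is at most 1/2, still below (d
  -- - 4)/8.
  have habs : |((w : ℝ) - 4) / 8| ≤ ((d : ℝ) - 4) / 8 := by
    rw [abs_le]
    constructor <;> linarith
  have hpow : (((w : ℝ) - 4) / 8) ^ r ≤ (((d : ℝ) - 4) / 8) ^ r :=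
    (le_abs_self _).trans (by rw [abs_pow]; exact pow_le_pow_left₀ (abs_nonneg _) habs _)
  obtain ⟨m, rfl⟩ := Nat.exists_eq_add_of_le' hr
  rw [Nat.add_sub_cancel]
  set z : ℝ := ((d : ℝ) - 4) / 8 with hz
  have hz0 : 0 ≤ z ^ m := pow_nonneg (by rw [hz]; linarith) _
  calc 2 * (((w : ℝ) - 4) / 8) ^ (m + 1) * (s : ℝ) ≤ 2 * z ^ (m + 1) * s := by gcongr
    _ = (2 * z * s) * z ^ m := by ring
    _ ≤ ((d : ℝ) * (s : ℝ) / 4) * z ^ m := by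
        refine mul_le_mul_of_nonneg_right ?_ hz0
        have : 2 * z ≤ (d : ℝ) / 4 := by rw [hz]; linarith
        have := mul_le_mul_of_nonneg_right this (Nat.cast_nonneg (α := ℝ) s)
        linarith

theorem mainTheorem2 (d s r : ℕ) (hd : 14 ≤ d) (hs : 1 ≤ s) (hr : ∃ k : ℕ, r = 2 ^ k) :
    ∃ (V : Type) (_ : Fintype V) (_ : DecidableEq V) (G : SimpleGraph V),
      G.twinWidth ≤ d ∧
      G.bicliqueNumber = s ∧
      (G.scol r : ℝ) ≥ ((d : ℝ) * (s : ℝ) / 4) * (((d : ℝ) - 4) / 8) ^ (r - 1) ∧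
      ((d : ℝ) * (s : ℝ) / 4) * (((d : ℝ) - 4) / 8) ^ (r - 1) ≥
        2 * (((G.twinWidth : ℝ) - 4) / 8) ^ r * (G.bicliqueNumber : ℝ) := by
  have hr1 : 1 ≤ r := by
    obtain ⟨k, rfl⟩ := hr
    exact Nat.one_le_two_pow
  -- ⌈d/4⌉ satisfies d ≤ 4q, needed for the colouring bound, and 3q + 1 ≤ d, needed for twin-width,
  -- when d ≥ 14.
  obtain ⟨V, hV, hV', G, htww, hbic, hscol⟩ := SimpleGraph.exists_blowUp ((d + 3) / 4) r s d
    (by omega) hr1 hs (by omega)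
  refine ⟨V, hV, hV', G, htww, hbic, ?_, ?_⟩
  · refine (coloring_bound_le d s ((d + 3) / 4) r hd hr1 (by omega)).trans ?_
    exact_mod_cast hscol
  · rw [hbic]
    exact twinWidth_bound_le d s r _ hd hr1 htww
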